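/- **Model.** Fix a number of layers $M\ge 1$, hyperedge sizes $d_1,\dots,d_M\ge 2$, and real parameters $\alpha^{(m)}_{(r,d_m-r)}>0$ for $1\le m\le M$, $0\le r\le d_m$, all independent of $N$, that are symmetric: $\alpha^{(m)}_{(r,d_m-r)}=\alpha^{(m)}_{(d_m-r,r)}$. For even $N$, let $\sigma=\sigma^{(N)}$ be uniformly distributed on the vectors in $\{-1,+1\}^N$ with as many entries $+1$ as $-1$. Given $\sigma$, let $A=(A^{(m)}_e)$, indexed by $m\in[M]$ and $e\subset[N]$ with $|e|=d_m$, consist of independent Bernoulli variables with $$\mathbb P\big(A^{(m)}_e=1\mid\sigma\big)=\frac{\alpha^{(m)}_{(\tau_{-1}(e),\tau_{+1}(e))}\log N}{\binom{N-1}{d_m-1}}\wedge 1,\qquad \tau_k(e)=|\{i\in e:\sigma_i=k\}|.$$ Let $W$ be the aggregate similarity matrix: $W_{ii}=0$ and $W_{ij}=\sum_{m=1}^M\sum_{e\ni i,j}A^{(m)}_e$ for $i\ne j$. Put $$\psi(\lambda)=\sum_{m=1}^M\sum_{r=0}^{d_m-1}2^{-(d_m-1)}\binom{d_m-1}{r}\alpha^{(m)}_{(r,d_m-r)}\big(1-e^{-\lambda(d_m-1-2r)}\big),\qquad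 I=\sup_{\lambda\in\mathbb R}\psi(\lambda),$$ $$\xi=\sum_{m=1}^M2^{-(d_m-1)}\sum_{r=0}^{d_m-1}\binom{d_m-1}{r}(d_m-1-2r)\,\alpha^{(m)}_{(r,d_m-r)}.$$ **Algorithm.** On input a symmetric $N\times N$ matrix $W$ and $s\in\{\pm1\}$: take an optimal solution $X^*$ of $$\text{maximize}\ \sum_{1\le i<j\le N}sW_{ij}X_{ij}\quad\text{subject to}\quad\sum_{i,j=1}^N X_{ij}=0,\quad X_{ii}=1\ (i\in[N]),\quad X\succeq0,$$ take an eigendecomposition $X^*=\sum_{i=1}^N\lambda_iv_iv_i^{\mathsf T}$ with $(v_i)$ an orthonormal basis of $\mathbb R^N$ and $\lambda_1\ge\dots\ge\lambda_N$, and output $\hat\sigma=\operatorname{sgn}(v_1)$ (entrywise). **Theorem.** If $I>1$, then $\xi\neq0$, and the algorithm run with inputs $W$ and $s=\operatorname{sgn}(\xi)$ achieves exact recovery: $$\lim_{N\to\infty,\ N\text{ even}}\mathbb P\big(\hat\sigma\in\{\sigma,-\sigma\}\big)=1,$$ whichever optimal solutions and eigendecompositions the algorithm chooses (that is, with probability tending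 to $1$ the algorithm has an output and all its possible outputs lie in $\{\sigma,-\sigma\}$). This covers both the assortative case $\xi>0$ and the disassortative case $\xi<0$. -/

import Mathlib

namespace HSBM

open MeasureTheory ProbabilityTheory

/-- Hyperedge slots of a multilayer hypergraph on the node set `Fin N`: a slot `⟨m, e⟩` is a
layer `m` together with a node set `e` of size `d m`. -/
abbrev Slot {M : ℕ} (N : ℕ) (d : Fin M → ℕ) : Type :=
  Σ m : Fin M, {e : Finset (Fin N) // e.card = d m}

/-- A multilayer hypergraph, as a binary array indexed by the hyperedge slots. -/
abbrev Hypergraph {M : ℕ} (N : ℕ) (d : Fin M → ℕ) : Type := Slot N d → Bool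

/-- The balanced community structures: `±1` vectors with as many entries `+1` as `-1`. -/
def balanced (N : ℕ) : Set (Fin N → ℤ) :=
  {σ | (∀ i, σ i = 1 ∨ σ i = -1) ∧
    (Finset.univ.filter fun i => σ i = 1).card = (Finset.univ.filter fun i => σ i = -1).card}

/-- The community profile `(τ₋₁(e), τ₊₁(e))` of a node set `e`. -/
def profile {N : ℕ} (σ : Fin N → ℤ) (e : Finset (Fin N)) : ℕ × ℕ :=
  ((e.filter fun i => σ i = -1).card, (e.filter fun i => σ i = 1).card)

/-- The probability `(α log N / binom (N - 1) (d - 1)) ∧ 1` of a hyperedge of size `d`. -/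
noncomputable def edgeProb (N d : ℕ) (a : ℝ) : ℝ :=
  min (a * Real.log N / ((N - 1).choose (d - 1) : ℝ)) 1

/-- The conditional law of the hypergraph given the community structure `σ`: independent
Bernoulli entries.  The projection to `[0, 1]` is the identity on the probabilities that occur
(they are nonnegative when the parameters are, and at most `1`). -/
noncomputable def condLaw {M : ℕ} (N : ℕ) (d : Fin M → ℕ) (α : Fin M → ℕ × ℕ → ℝ)
    (σ : Fin N → ℤ) : Measure (Hypergraph N d) :=
  Measure.pi fun q : Slot N d =>
    bernoulliMeasure true false
      (Set.projIcc (0 : ℝ) 1 zero_le_one (edgeProb N (d q.1) (α q.1 (profile σ q.2.1))))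

/-- The joint law of `(σ, A)`: `σ` is uniform on the balanced community structures, and `A` has
its conditional law given `σ`. (For odd `N` there is no balanced structure, and this is `0`.) -/
noncomputable def law {M : ℕ} (N : ℕ) (d : Fin M → ℕ) (α : Fin M → ℕ × ℕ → ℝ) :
    Measure ((Fin N → ℤ) × Hypergraph N d) :=
  (uniformOn (balanced N)).compProd (Kernel.ofFunOfCountable (condLaw N d α))

/-- The symmetry assumption `α_(r, d - r) = α_(d - r, r)` in every layer. -/
def IsSymmetric {M : ℕ} (d : Fin M → ℕ) (α : Fin M → ℕ × ℕ → ℝ) : Prop :=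
  ∀ m, ∀ r ≤ d m, α m (r, d m - r) = α m (d m - r, r)

/-- The similarity matrix of layer `m`: off the diagonal, the entry `(i, j)` is the number of
hyperedges of the layer that contain both `i` and `j`. -/
noncomputable def layerSimilarity {M N : ℕ} {d : Fin M → ℕ} (A : Hypergraph N d) (m : Fin M) :
    Matrix (Fin N) (Fin N) ℝ :=
  fun i j => if i = j then 0 else
    ∑ e : {e : Finset (Fin N) // e.card = d m},
      if i ∈ e.1 ∧ j ∈ e.1 ∧ A ⟨m, e⟩ = true then 1 else 0

/-- The aggregate similarity matrix. -/
noncomputable def similarity {M N : ℕ} {d : Fin M → ℕ} (A : Hypergraph N d) :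
    Matrix (Fin N) (Fin N) ℝ :=
  ∑ m, layerSimilarity A m

/-- The assortativity `ξ`. -/
noncomputable def assortativity {M : ℕ} (d : Fin M → ℕ) (α : Fin M → ℕ × ℕ → ℝ) : ℝ :=
  ∑ m, ((2 : ℝ) ^ (d m - 1))⁻¹ * ∑ r ∈ Finset.range (d m),
    ((d m - 1).choose r : ℝ) * ((d m : ℝ) - 1 - 2 * r) * α m (r, d m - r)

/-- The function `ψ` whose supremum is the information quantity. -/
noncomputable def psi {M : ℕ} (d : Fin M → ℕ) (α : Fin M → ℕ × ℕ → ℝ) (x : ℝ) : ℝ :=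
  ∑ m, ∑ r ∈ Finset.range (d m),
    ((2 : ℝ) ^ (d m - 1))⁻¹ * ((d m - 1).choose r : ℝ) * α m (r, d m - r) *
      (1 - Real.exp (-x * ((d m : ℝ) - 1 - 2 * r)))

/-- The information quantity `I`.  (For nonnegative parameters `ψ` is bounded above, so this is
the true supremum.) -/
noncomputable def information {M : ℕ} (d : Fin M → ℕ) (α : Fin M → ℕ × ℕ → ℝ) : ℝ :=
  ⨆ x : ℝ, psi d α x

/-- The feasible set of the semidefinite program. -/
def sdpFeasible (N : ℕ) : Set (Matrix (Fin N) (Fin N) ℝ) :=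
  {X | ∑ i, ∑ j, X i j = 0 ∧ (∀ i, X i i = 1) ∧ X.PosSemidef}

/-- The objective `∑_{i < j} s W_ij X_ij` of the semidefinite program. -/
def sdpObjective {N : ℕ} (W : Matrix (Fin N) (Fin N) ℝ) (s : ℝ)
    (X : Matrix (Fin N) (Fin N) ℝ) : ℝ :=
  ∑ i, ∑ j ∈ Finset.univ.filter (fun j => i < j), s * W i j * X i j

/-- `X` is an optimal solution of the semidefinite program. -/
def IsSDPSolution {N : ℕ} (W : Matrix (Fin N) (Fin N) ℝ) (s : ℝ)
    (X : Matrix (Fin N) (Fin N) ℝ) : Prop :=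
  X ∈ sdpFeasible N ∧ ∀ Y ∈ sdpFeasible N, sdpObjective W s Y ≤ sdpObjective W s X

/-- The possible outputs of the algorithm with inputs `W` and `s`: choose an optimal solution `X`
and an eigendecomposition `X = ∑ k, μ k • v k (v k)ᵀ` with `v` an orthonormal basis and
`μ` nonincreasing, and output the entrywise sign of the first eigenvector. -/
def sdpOutputs {N : ℕ} (W : Matrix (Fin N) (Fin N) ℝ) (s : ℝ) : Set (Fin N → ℤ) :=
  {τ | ∃ (hN : 0 < N) (X : Matrix (Fin N) (Fin N) ℝ) (μ : Fin N → ℝ)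
      (v : OrthonormalBasis (Fin N) ℝ (EuclideanSpace ℝ (Fin N))),
    IsSDPSolution W s X ∧ Antitone μ ∧
    (∀ i j, X i j = ∑ k, μ k * (v k i * v k j)) ∧
    ∀ i, τ i = (SignType.sign (v ⟨0, hN⟩ i) : ℤ)}

/-- Recovery of the community structure up to a global sign, for an algorithm whose steps leave
choices open: there is an output, and every output is `σ` or `-σ`. -/
def Recovers {N : ℕ} (outputs : Set (Fin N → ℤ)) (σ : Fin N → ℤ) : Prop :=
  outputs.Nonempty ∧ ∀ τ ∈ outputs, τ = σ ∨ τ = -σ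

end HSBM

/-! The argument separates a deterministic certificate from concentration estimates at scale `log
N`.

Write the margin of node `i` as `∑ j, s W_ij σ_i σ_j`, and let `D` be the diagonal matrix of
margins. Then `(D - s W) σ = 0`. If `D - s W` is positive definite on the orthogonal complement of
`1` and `σ`, then `σ σᵀ` is the unique optimum: a feasible `X` is a sum of `b bᵀ` with zero-sum
vectors `b`, and since `X_ii = 1`, twice the gap in the objective is the sum of the forms of `D - s
W` at these `b`. The top eigenvector of `σ σᵀ` is a multiple of `σ`, which gives
`DualCertificate.recovers`. It remains to show that the margins dominate the form of `W` on that
complement.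

Margins. Choose `x` with `ψ(x) > 1`. The tangent bound `ψ(x) ≤ ξ x` forces `ξ ≠ 0`, and `x` has the
sign `s` of `ξ`. The signed incidences at a node are sums over independent hyperedges, and by the
symmetry of `α` their log-Laplace transform at `x` is `-log N` times a quantity tending to `ψ(x)`,
in both communities (`sum_prob_margin`). Chernoff's bound then beats the union bound over the `N`
nodes, and all margins exceed `c log N` for some `c > 0` (`Bounds.negligible_margin`).

The form of `W`. It must be at most a fraction of `c log N` times the squared norm. The conditional
mean takes two values off the diagonal, so on the complement of `1` and `σ` only a multiple of the
identity of size `O(log N / N)` is left. For the deviation from the mean, `abs_quadraticForm_sub_le`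
asks for three uniform facts: row sums `O(log N)`, cut norm at most a small multiple of `N log N`,
and at most a small multiple of `log N` per node for the weight inside small sets. Small coordinates
are treated by the cut norm, large ones by the other two facts and the uniform smallness of the
mean. Each fact concerns linear statistics of independent hyperedges, so Chernoff and union bounds
suffice although the entries of `W` are dependent. These bounds are two-sided, so `s` matters only
for the margins.

All estimates are uniform in the balanced `σ` and are averaged at the end. -/

namespace HSBM

/-! ### Semidefinite optimality and recovery from a dual certificate -/

/-- A dual certificate for optimality of the planted solution `x xᵀ`: the matrix `D - s W`, with
`D` the diagonal matrix which makes `x` a kernel vector, is positive definite on the orthogonal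
complement of `x` and the constants. -/
def DualCertificate {N : ℕ} (W : Matrix (Fin N) (Fin N) ℝ) (s : ℝ) (x : Fin N → ℝ) : Prop :=
  ∀ z : Fin N → ℝ, ∑ i, z i = 0 → ∑ i, x i * z i = 0 → z ≠ 0 →
    ∑ i, ∑ j, s * W i j * (z i * z j) < ∑ i, (∑ j, s * W i j * (x i * x j)) * z i ^ 2

lemma sum_lt_eq_half {N : ℕ} (f : Fin N → Fin N → ℝ) (hf : ∀ i j, f i j = f j i)
    (h0 : ∀ i, f i i = 0) :
    2 * ∑ i, ∑ j ∈ Finset.univ.filter (fun j => i < j), f i j = ∑ i, ∑ j, f i j := by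
  have h1 : ∀ i j, f i j = (if i < j then f i j else 0) + (if j < i then f j i else 0) := by
    intro i j
    rcases lt_trichotomy i j with h | h | h
    · simp [h, h.not_gt]
    · subst h; simp [h0]
    · simp [h, h.not_gt, hf i j]
  have h2 : ∑ i, ∑ j, f i j = ∑ i, ∑ j, ((if i < j then f i j else 0) +
      (if j < i then f j i else 0)) :=
    Finset.sum_congr rfl fun i _ => Finset.sum_congr rfl fun j _ => h1 i j
  rw [h2]
  simp only [Finset.sum_add_distrib, Finset.sum_filter]
  rw [Finset.sum_comm (f := fun i j => if j < i then f j i else 0)]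
  ring

section Certificate

variable {N : ℕ} {W : Matrix (Fin N) (Fin N) ℝ} {s : ℝ} {x : Fin N → ℝ}

/-- The quadratic form of the dual certificate is unchanged by translations along `x`. -/
lemma certificate_shift (hW : ∀ i j, W i j = W j i) (hx : ∀ i, x i ^ 2 = 1)
    (z : Fin N → ℝ) (a : ℝ) :
    ∑ i, (∑ j, s * W i j * (x i * x j)) * (z i + a * x i) ^ 2 -
      ∑ i, ∑ j, s * W i j * ((z i + a * x i) * (z j + a * x j)) =
    ∑ i, (∑ j, s * W i j * (x i * x j)) * z i ^ 2 - ∑ i, ∑ j, s * W i j * (z i * z j) := by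
  have e1 : ∑ i, ∑ j, s * W i j * (x i * z j) = ∑ i, ∑ j, s * W i j * (z i * x j) := by
    rw [Finset.sum_comm]
    refine Finset.sum_congr rfl fun i _ => Finset.sum_congr rfl fun j _ => ?_
    rw [hW j i]; ring
  have e2 : ∑ i, ∑ j, s * W i j * ((z i + a * x i) * (z j + a * x j)) =
      ∑ i, ∑ j, s * W i j * (z i * z j) + 2 * a * ∑ i, ∑ j, s * W i j * (z i * x j) +
        a ^ 2 * ∑ i, ∑ j, s * W i j * (x i * x j) := by
    have : ∑ i, ∑ j, s * W i j * ((z i + a * x i) * (z j + a * x j)) =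
      ∑ i, ∑ j, s * W i j * (z i * z j) + a * ∑ i, ∑ j, s * W i j * (z i * x j) +
        a * ∑ i, ∑ j, s * W i j * (x i * z j) +
        a ^ 2 * ∑ i, ∑ j, s * W i j * (x i * x j) := by
      simp only [Finset.mul_sum, ← Finset.sum_add_distrib]
      refine Finset.sum_congr rfl fun i _ => Finset.sum_congr rfl fun j _ => ?_
      ring
    rw [this, e1]; ring
  -- `x i ^ 2 = 1` gives `D x = s W x`, so the cross term and the square term in `a` agree with
  -- those of `s W` and cancel.
  have e3 : ∑ i, (∑ j, s * W i j * (x i * x j)) * (z i + a * x i) ^ 2 =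
      ∑ i, (∑ j, s * W i j * (x i * x j)) * z i ^ 2 +
        2 * a * ∑ i, ∑ j, s * W i j * (z i * x j) +
        a ^ 2 * ∑ i, ∑ j, s * W i j * (x i * x j) := by
    simp only [Finset.mul_sum, ← Finset.sum_add_distrib, Finset.sum_mul]
    refine Finset.sum_congr rfl fun i _ => Finset.sum_congr rfl fun j _ => ?_
    linear_combination (2 * a * s * W i j * z i * x j + a ^ 2 * s * W i j * x i * x j) * hx i
  rw [e2, e3]; ring

/-- A zero-sum vector at which the quadratic form of the certificate vanishes is a multiple of
`x`, and the form is nonnegative on zero-sum vectors. -/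
lemma DualCertificate.form (h : DualCertificate W s x) (hW : ∀ i j, W i j = W j i)
    (hN : 0 < N) (hx : ∀ i, x i ^ 2 = 1) (hx0 : ∑ i, x i = 0) (y : Fin N → ℝ)
    (hy : ∑ i, y i = 0) :
    0 ≤ ∑ i, (∑ j, s * W i j * (x i * x j)) * y i ^ 2 - ∑ i, ∑ j, s * W i j * (y i * y j) ∧
    (∑ i, (∑ j, s * W i j * (x i * x j)) * y i ^ 2 - ∑ i, ∑ j, s * W i j * (y i * y j) = 0 →
      ∃ c : ℝ, ∀ i, y i = c * x i) := by
  have hN' : (N : ℝ) ≠ 0 := by positivity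
  -- The coefficient of the orthogonal projection onto `x`, whose squared norm is `N`.
  set a : ℝ := (∑ i, x i * y i) / N with ha
  set z : Fin N → ℝ := fun i => y i - a * x i with hz
  have hyz : ∀ i, y i = z i + a * x i := fun i => by simp [hz]
  have hxx : ∑ i, x i * x i = (N : ℝ) := by
    simp [← sq, hx]
  have hz1 : ∑ i, z i = 0 := by
    simp [hz, Finset.sum_sub_distrib, hy, ← Finset.mul_sum, hx0]
  have hz2 : ∑ i, x i * z i = 0 := by
    have : ∑ i, x i * z i = ∑ i, x i * y i - a * ∑ i, x i * x i := by
      rw [Finset.mul_sum, ← Finset.sum_sub_distrib]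
      exact Finset.sum_congr rfl fun i _ => by simp [hz]; ring
    rw [this, hxx, ha]; field_simp; ring
  have key := certificate_shift (s := s) hW hx z a
  simp only [← hyz] at key
  rw [key]
  by_cases h0 : z = 0
  · refine ⟨by simp [h0], fun _ => ⟨a, fun i => ?_⟩⟩
    rw [hyz i, h0]; simp
  · have := h z hz1 hz2 h0
    exact ⟨by linarith, fun h' => by linarith⟩

lemma sdpObjective_eq (hW : ∀ i j, W i j = W j i) (hW0 : ∀ i, W i i = 0)
    (X : Matrix (Fin N) (Fin N) ℝ) (hX : ∀ i j, X i j = X j i) :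
    2 * sdpObjective W s X = ∑ i, ∑ j, s * W i j * X i j :=
  sum_lt_eq_half _ (fun i j => by rw [hW i j, hX i j]) (fun i => by simp [hW0])

lemma outer_mem_sdpFeasible (hx : ∀ i, x i ^ 2 = 1) (hx0 : ∑ i, x i = 0) :
    Matrix.of (fun i j => x i * x j) ∈ sdpFeasible N := by
  refine ⟨?_, fun i => by simp [← sq, hx], ?_⟩
  · simp [← Finset.mul_sum, hx0]
  · have := Matrix.posSemidef_vecMulVec_self_star x
    convert this using 1
    ext i j
    simp [Matrix.vecMulVec_apply]

/-- Under a dual certificate, the planted solution is at least as good as any other feasible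
point, with equality only at the planted solution. -/
lemma DualCertificate.objective (h : DualCertificate W s x) (hW : ∀ i j, W i j = W j i)
    (hW0 : ∀ i, W i i = 0) (hN : 0 < N) (hx : ∀ i, x i ^ 2 = 1) (hx0 : ∑ i, x i = 0)
    (X : Matrix (Fin N) (Fin N) ℝ) (hX : X ∈ sdpFeasible N) :
    sdpObjective W s X ≤ sdpObjective W s (Matrix.of fun i j => x i * x j) ∧
    (sdpObjective W s (Matrix.of fun i j => x i * x j) ≤ sdpObjective W s X →
      ∀ i j, X i j = x i * x j) := by
  obtain ⟨hX0, hX1, hXp⟩ := hX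
  obtain ⟨m, B, hB⟩ := Matrix.posSemidef_iff_eq_sum_vecMulVec.mp hXp
  have hXB : ∀ i j, X i j = ∑ k, B k i * B k j := by
    intro i j
    rw [hB]; simp [Matrix.sum_apply, Matrix.vecMulVec_apply]
  -- The sum of all entries of `X` is the sum over `k` of the squares of these sums, so the linear
  -- constraint annihilates each of them.
  have hBsum : ∀ k, ∑ i, B k i = 0 := by
    have h1 : ∑ k, (∑ i, B k i) ^ 2 = 0 := by
      rw [← hX0]
      simp only [hXB, sq, Finset.sum_mul_sum]
      rw [Finset.sum_comm]
      exact Finset.sum_congr rfl fun i _ => Finset.sum_comm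
    intro k
    have := (Finset.sum_eq_zero_iff_of_nonneg (fun k _ => sq_nonneg _)).mp h1 k (Finset.mem_univ k)
    exact pow_eq_zero_iff (two_ne_zero) |>.mp this
  -- The constraint `X i i = 1`, that is `∑ k, B k i ^ 2 = 1`, is what turns the planted objective
  -- into the diagonal part of the forms.
  have hdiff : 2 * sdpObjective W s (Matrix.of fun i j => x i * x j) - 2 * sdpObjective W s X =
      ∑ k, (∑ i, (∑ j, s * W i j * (x i * x j)) * B k i ^ 2 -
        ∑ i, ∑ j, s * W i j * (B k i * B k j)) := by
    rw [sdpObjective_eq hW hW0 _ (fun i j => by simp [mul_comm]), sdpObjective_eq hW hW0 X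
      (fun i j => by simp only [hXB, mul_comm]), Finset.sum_sub_distrib]
    congr 1
    · symm
      rw [Finset.sum_comm]
      refine Finset.sum_congr rfl fun i _ => ?_
      have : ∑ k, B k i ^ 2 = 1 := by rw [← hX1 i, hXB]; simp [sq]
      rw [← Finset.mul_sum, this]; simp
    · symm
      rw [Finset.sum_comm]
      refine Finset.sum_congr rfl fun i _ => ?_
      rw [Finset.sum_comm]
      refine Finset.sum_congr rfl fun j _ => ?_
      rw [← Finset.mul_sum, hXB]
  have hform := fun k => h.form hW hN hx hx0 (B k) (hBsum k)
  have hnn : 0 ≤ ∑ k, (∑ i, (∑ j, s * W i j * (x i * x j)) * B k i ^ 2 -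
        ∑ i, ∑ j, s * W i j * (B k i * B k j)) := Finset.sum_nonneg fun k _ => (hform k).1
  refine ⟨by linarith, fun hle => ?_⟩
  have hz : ∑ k, (∑ i, (∑ j, s * W i j * (x i * x j)) * B k i ^ 2 -
        ∑ i, ∑ j, s * W i j * (B k i * B k j)) = 0 := by linarith
  have hk := fun k => (hform k).2 ((Finset.sum_eq_zero_iff_of_nonneg
    (fun k _ => (hform k).1)).mp hz k (Finset.mem_univ k))
  choose c hc using hk
  have hXc : ∀ i j, X i j = (∑ k, c k ^ 2) * (x i * x j) := by
    intro i j
    rw [hXB, Finset.sum_mul]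
    exact Finset.sum_congr rfl fun k _ => by rw [hc k i, hc k j]; ring
  have hc1 : ∑ k, c k ^ 2 = 1 := by
    have := hXc ⟨0, hN⟩ ⟨0, hN⟩
    rw [hX1, ← sq, hx, mul_one] at this
    exact this.symm
  intro i j
  rw [hXc, hc1, one_mul]

end Certificate

/-- A planted rank-one matrix has an eigendecomposition with first eigenvector along `x`. -/
lemma exists_eigendecomposition_outer {N : ℕ} (hN : 0 < N) (x : Fin N → ℝ)
    (hx : ∀ i, x i ^ 2 = 1) :
    ∃ (μ : Fin N → ℝ) (v : OrthonormalBasis (Fin N) ℝ (EuclideanSpace ℝ (Fin N))),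
      Antitone μ ∧ (∀ i j, x i * x j = ∑ k, μ k * (v k i * v k j)) ∧
      ∀ i, v ⟨0, hN⟩ i = (√(N : ℝ))⁻¹ * x i := by
  have hN' : (0 : ℝ) < N := by exact_mod_cast hN
  set u : EuclideanSpace ℝ (Fin N) := WithLp.toLp 2 fun i => (√(N : ℝ))⁻¹ * x i with hu
  have hun : ‖u‖ = 1 := by
    rw [EuclideanSpace.norm_eq]
    simp only [hu, Real.norm_eq_abs, sq_abs, mul_pow, hx, inv_pow, Real.sq_sqrt hN'.le]
    simp [hN'.ne']
  have hon : Orthonormal ℝ (({⟨0, hN⟩} : Set (Fin N)).domRestrict fun _ => u) := by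
    constructor
    · intro i; exact hun
    · rintro ⟨i, hi⟩ ⟨j, hj⟩ hij
      exact absurd (Subtype.ext (hi.trans hj.symm)) hij
  obtain ⟨b, hb⟩ := hon.exists_orthonormalBasis_extension_of_card_eq (by simp)
  have hb0 : b ⟨0, hN⟩ = u := hb _ rfl
  refine ⟨fun k => if k = ⟨0, hN⟩ then (N : ℝ) else 0, b, ?_, ?_, ?_⟩
  · intro i j hij
    by_cases hj : j = ⟨0, hN⟩
    · have : i = ⟨0, hN⟩ := by
        subst hj; exact Fin.ext (Nat.le_zero.mp hij)
      simp [hj, this]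
    · simp only [hj, if_false]
      split_ifs <;> positivity
  · intro i j
    simp only [ite_mul, zero_mul, Finset.sum_ite_eq', Finset.mem_univ, if_true, hb0, hu]
    have : (√(N : ℝ)) ^ 2 = N := Real.sq_sqrt hN'.le
    have h2 : √(N : ℝ) ≠ 0 := by positivity
    field_simp
    rw [this]
  · intro i; rw [hb0]

/-- In any ordered eigendecomposition of `x xᵀ`, the first eigenvector is a nonzero multiple
of `x`. -/
lemma first_eigenvector_outer {N : ℕ} (hN : 0 < N) (x : Fin N → ℝ) (hx : ∀ i, x i ^ 2 = 1)
    (μ : Fin N → ℝ) (v : OrthonormalBasis (Fin N) ℝ (EuclideanSpace ℝ (Fin N)))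
    (hμ : Antitone μ) (h : ∀ i j, x i * x j = ∑ k, μ k * (v k i * v k j)) :
    ∃ c : ℝ, c ≠ 0 ∧ ∀ i, v ⟨0, hN⟩ i = c * x i := by
  have hN' : (0 : ℝ) < N := by exact_mod_cast hN
  have hinner : ∀ k l, ∑ i, v k i * v l i = if k = l then 1 else 0 := by
    intro k l
    have := orthonormal_iff_ite.mp v.orthonormal k l
    rw [← this, PiLp.inner_apply]
    simp [mul_comm]
  have htr : ∑ k, μ k = N := by
    have h1 : ∑ i, x i * x i = (N : ℝ) := by simp [← sq, hx]
    rw [← h1]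
    simp only [h]
    rw [Finset.sum_comm]
    refine Finset.sum_congr rfl fun k _ => ?_
    rw [← Finset.mul_sum, hinner]; simp
  -- The first eigenvalue is the largest; were it nonpositive, the trace `N` would be nonpositive
  -- too.
  have hμ0 : 0 < μ ⟨0, hN⟩ := by
    by_contra hneg
    have : ∑ k, μ k ≤ 0 := Finset.sum_nonpos fun k _ =>
      (hμ (show (⟨0, hN⟩ : Fin N) ≤ k from Nat.zero_le _)).trans (not_lt.mp hneg)
    linarith
  have heig : ∀ i, x i * ∑ j, x j * v ⟨0, hN⟩ j = μ ⟨0, hN⟩ * v ⟨0, hN⟩ i := by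
    intro i
    calc x i * ∑ j, x j * v ⟨0, hN⟩ j = ∑ j, (x i * x j) * v ⟨0, hN⟩ j := by
          rw [Finset.mul_sum]; exact Finset.sum_congr rfl fun j _ => by ring
      _ = ∑ j, ∑ k, μ k * v k i * (v k j * v ⟨0, hN⟩ j) := by
          refine Finset.sum_congr rfl fun j _ => ?_
          rw [h, Finset.sum_mul]
          exact Finset.sum_congr rfl fun k _ => by ring
      _ = ∑ k, μ k * v k i * ∑ j, v k j * v ⟨0, hN⟩ j := by
          rw [Finset.sum_comm]
          exact Finset.sum_congr rfl fun k _ => by rw [Finset.mul_sum]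
      _ = _ := by simp [hinner]
  have hv : ∀ i, v ⟨0, hN⟩ i = (∑ j, x j * v ⟨0, hN⟩ j) / μ ⟨0, hN⟩ * x i := by
    intro i
    have := heig i
    field_simp
    linarith
  refine ⟨_, ?_, hv⟩
  intro hc
  have h0 : ∀ i, v ⟨0, hN⟩ i = 0 := fun i => by rw [hv i, hc, zero_mul]
  have := hinner ⟨0, hN⟩ ⟨0, hN⟩
  simp [h0] at this

lemma balanced_sq {N : ℕ} {σ : Fin N → ℤ} (hσ : σ ∈ balanced N) (i : Fin N) :
    ((σ i : ℝ)) ^ 2 = 1 := by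
  rcases hσ.1 i with h | h <;> simp [h]

lemma balanced_sum {N : ℕ} {σ : Fin N → ℤ} (hσ : σ ∈ balanced N) : ∑ i, (σ i : ℝ) = 0 := by
  have h1 : ∀ i, (σ i : ℝ) = (if σ i = 1 then 1 else 0) - (if σ i = -1 then 1 else 0) := by
    intro i
    rcases hσ.1 i with h | h <;> simp [h]
  simp only [h1, Finset.sum_sub_distrib, Finset.sum_boole]
  rw [hσ.2, sub_self]

/-- A dual certificate implies that the algorithm recovers the planted structure. -/
theorem DualCertificate.recovers {N : ℕ} {W : Matrix (Fin N) (Fin N) ℝ} {s : ℝ} {σ : Fin N → ℤ}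
    (h : DualCertificate W s (fun i => (σ i : ℝ))) (hσ : σ ∈ balanced N) (hN : 0 < N)
    (hW : ∀ i j, W i j = W j i) (hW0 : ∀ i, W i i = 0) : Recovers (sdpOutputs W s) σ := by
  have hx := balanced_sq hσ
  have hx0 := balanced_sum hσ
  have hobj := h.objective hW hW0 hN hx hx0
  have hfeas := outer_mem_sdpFeasible hx hx0
  have hN' : (0 : ℝ) < N := by exact_mod_cast hN
  constructor
  · obtain ⟨μ, v, hμ, hX, hv⟩ := exists_eigendecomposition_outer hN _ hx
    refine ⟨fun i => (SignType.sign (v ⟨0, hN⟩ i) : ℤ), hN, _, μ, v,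
      ⟨hfeas, fun Y hY => (hobj Y hY).1⟩, hμ, ?_, fun i => rfl⟩
    intro i j; simpa using hX i j
  · rintro τ ⟨_, X, μ, v, ⟨hXf, hXo⟩, hμ, hX, hτ⟩
    have hXx := (hobj X hXf).2 (hXo _ hfeas)
    obtain ⟨c, hc, hv⟩ := first_eigenvector_outer hN _ hx μ v hμ
      (fun i j => by rw [← hX i j, hXx i j])
    rcases lt_or_gt_of_ne hc with hneg | hpos
    · right
      funext i
      rw [hτ, hv]
      rcases hσ.1 i with h1 | h1 <;> simp [h1, hneg]
    · left
      funext i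
      rw [hτ, hv]
      rcases hσ.1 i with h1 | h1 <;> simp [h1, hpos]


/-! ### Deterministic bound for the quadratic form of the deviation -/

/-- If every subset of `H` has weight density at most `k`, then so does every nonnegative
function on `H`. -/
lemma sum_min_le_of_density {ι : Type*} [DecidableEq ι] (w : ι → ι → ℝ) (k : ℝ) (H : Finset ι) :
    ∀ (b : ι → ℝ), (∀ i ∈ H, 0 ≤ b i) →
    (∀ U ⊆ H, ∑ i ∈ U, ∑ j ∈ U, w i j ≤ k * U.card) →
    ∑ i ∈ H, ∑ j ∈ H, w i j * min (b i) (b j) ≤ k * ∑ i ∈ H, b i := by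
  induction H using Finset.strongInduction with
  | H H ih =>
    intro b hb hU
    rcases H.eq_empty_or_nonempty with rfl | hne
    · simp
    -- Layer-cake decomposition: the bottom layer `b m` is paid for by the density of all of `H`,
    -- and `b - b m` vanishes at `m`, so induction applies to `H.erase m`.
    obtain ⟨m, hm, hmin⟩ := H.exists_min_image b hne
    have hIH := ih (H.erase m) (Finset.erase_ssubset hm) (fun i => b i - b m)
      (fun i hi => sub_nonneg.mpr (hmin i (Finset.mem_of_mem_erase hi)))
      (fun U hUs => hU U (hUs.trans (Finset.erase_subset m H)))
    have e1 : ∑ i ∈ H, ∑ j ∈ H, w i j * min (b i) (b j) =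
        ∑ i ∈ H, ∑ j ∈ H, w i j * min (b i - b m) (b j - b m) +
          b m * ∑ i ∈ H, ∑ j ∈ H, w i j := by
      simp only [Finset.mul_sum, ← Finset.sum_add_distrib]
      refine Finset.sum_congr rfl fun i _ => Finset.sum_congr rfl fun j _ => ?_
      rw [min_sub_sub_right]; ring
    have hz : ∀ i ∈ H, ∀ j ∈ H, i = m ∨ j = m → min (b i - b m) (b j - b m) = 0 := by
      intro i hi j hj h
      have h1 := hmin i hi
      have h2 := hmin j hj
      rcases h with rfl | rfl
      · rw [sub_self]; exact min_eq_left (by linarith)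
      · rw [sub_self]; exact min_eq_right (by linarith)
    have e2 : ∑ i ∈ H, ∑ j ∈ H, w i j * min (b i - b m) (b j - b m) =
        ∑ i ∈ H.erase m, ∑ j ∈ H.erase m, w i j * min (b i - b m) (b j - b m) := by
      symm
      rw [← Finset.sum_subset (Finset.erase_subset m H)
        (f := fun i => ∑ j ∈ H, w i j * min (b i - b m) (b j - b m))]
      · refine Finset.sum_congr rfl fun i hi => ?_
        refine Finset.sum_subset (Finset.erase_subset m H) fun j hj hj' => ?_
        have : j = m := by simpa [hj] using hj'
        rw [hz i (Finset.mem_of_mem_erase hi) j hj (Or.inr this), mul_zero]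
      · intro i hi hi'
        have : i = m := by simpa [hi] using hi'
        exact Finset.sum_eq_zero fun j hj => by rw [hz i hi j hj (Or.inl this), mul_zero]
    have e3 : ∑ i ∈ H.erase m, (b i - b m) = ∑ i ∈ H, b i - b m * H.card := by
      have : ∑ i ∈ H.erase m, (b i - b m) = ∑ i ∈ H, (b i - b m) :=
        Finset.sum_erase _ (sub_self _)
      rw [this, Finset.sum_sub_distrib]; simp [mul_comm]
    rw [e1, e2]
    rw [e3] at hIH
    have := mul_le_mul_of_nonneg_left (hU H subset_rfl) (hb m hm)
    nlinarith

/-- The sign attached to a truth value. -/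
def signOf (b : Bool) : ℝ := if b then 1 else -1

lemma exists_signOf_mul (r : ℝ) : ∃ b, signOf b * r = |r| := by
  rcases le_total 0 r with h | h
  · exact ⟨true, by simp [signOf, abs_of_nonneg h]⟩
  · exact ⟨false, by simp [signOf, abs_of_nonpos h]⟩

/-- A bilinear form on a cube is bounded by its values at the vertices. -/
lemma bilinear_le_of_signs {ι : Type*} [Fintype ι] (B : ι → ι → ℝ) (K a : ℝ) (ha : 0 ≤ a)
    (h : ∀ s t : ι → Bool, ∑ i, ∑ j, signOf (s i) * signOf (t j) * B i j ≤ K)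
    (y z : ι → ℝ) (hy : ∀ i, |y i| ≤ a) (hz : ∀ i, |z i| ≤ a) :
    ∑ i, ∑ j, B i j * (y i * z j) ≤ a ^ 2 * K := by
  -- The form is linear in each argument: `s` is the best vertex against `z`, then `t` the best
  -- vertex against `s`.
  choose s hs using fun i => exists_signOf_mul (∑ j, B i j * z j)
  choose t ht using fun j => exists_signOf_mul (∑ i, signOf (s i) * B i j)
  calc ∑ i, ∑ j, B i j * (y i * z j) = ∑ i, y i * ∑ j, B i j * z j := by
        refine Finset.sum_congr rfl fun i _ => ?_
        rw [Finset.mul_sum]; exact Finset.sum_congr rfl fun j _ => by ring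
    _ ≤ ∑ i, a * (signOf (s i) * ∑ j, B i j * z j) := by
        refine Finset.sum_le_sum fun i _ => ?_
        rw [hs]
        exact (le_abs_self _).trans (by rw [abs_mul]; gcongr; exact hy i)
    _ = a * ∑ j, z j * ∑ i, signOf (s i) * B i j := by
        rw [← Finset.mul_sum]; congr 1
        simp only [Finset.mul_sum]
        rw [Finset.sum_comm]
        exact Finset.sum_congr rfl fun j _ => Finset.sum_congr rfl fun i _ => by ring
    _ ≤ a * ∑ j, a * (signOf (t j) * ∑ i, signOf (s i) * B i j) := by
        refine mul_le_mul_of_nonneg_left (Finset.sum_le_sum fun j _ => ?_) ha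
        rw [ht]
        exact (le_abs_self _).trans (by rw [abs_mul]; gcongr; exact hz j)
    _ = a ^ 2 * ∑ i, ∑ j, signOf (s i) * signOf (t j) * B i j := by
        rw [← Finset.mul_sum, ← mul_assoc, ← sq]; congr 1
        simp only [Finset.mul_sum]
        rw [Finset.sum_comm]
        exact Finset.sum_congr rfl fun j _ => Finset.sum_congr rfl fun i _ => by ring
    _ ≤ a ^ 2 * K := mul_le_mul_of_nonneg_left (h s t) (sq_nonneg a)

/-- A product with a large factor is controlled by the squares of the factors, weighted by `η`,
unless both factors are large. -/
lemma abs_mul_abs_le {η a y z : ℝ} (hη : 0 < η) (hη1 : η ≤ 1) (ha : 0 < a)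
    (h : a < |y| ∨ a < |z|) :
    |y| * |z| ≤ η * (y ^ 2 + z ^ 2) +
      min (if η * a < |y| then y ^ 2 else 0) (if η * a < |z| then z ^ 2 else 0) / η := by
  wlog hyz : |z| ≤ |y| generalizing y z
  · rw [min_comm, mul_comm |y|, add_comm (y ^ 2)]
    exact this h.symm (le_of_not_ge hyz)
  have hy : a < |y| := h.elim id fun h => h.trans_le hyz
  have hηa : η * a ≤ a := by nlinarith
  have hsy : |y| ^ 2 = y ^ 2 := sq_abs y
  have hsz : |z| ^ 2 = z ^ 2 := sq_abs z
  have hz0 := abs_nonneg z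
  have hy0 := abs_nonneg y
  -- If the smaller factor is below `η` times the larger one, the term in `η` suffices. Otherwise
  -- both factors exceed `η * a`, and the product is at most the smaller square over `η`.
  by_cases hc : |z| ≤ η * |y|
  · have hmin : 0 ≤ min (if η * a < |y| then y ^ 2 else 0) (if η * a < |z| then z ^ 2 else 0) / η := by
      refine div_nonneg (le_min ?_ ?_) hη.le <;> split_ifs <;> positivity
    have : |y| * |z| ≤ η * |y| ^ 2 := by nlinarith
    have : 0 ≤ η * z ^ 2 := by positivity
    nlinarith
  · push Not at hc
    have hz : η * a < |z| := (mul_lt_mul_of_pos_left hy hη).trans hc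
    rw [if_pos (hηa.trans_lt hy), if_pos hz, min_eq_right (by rw [← hsy, ← hsz]; gcongr)]
    have h1 : |y| * |z| ≤ z ^ 2 / η := by
      rw [le_div_iff₀ hη, ← hsz]; nlinarith
    have : 0 ≤ η * (y ^ 2 + z ^ 2) := by positivity
    linarith

/-- A deterministic bound for the quadratic form of `w - p`, in terms of the row sums of `w`, the
cut norm of `w - p`, and the density of `w` on small sets. -/
theorem abs_quadraticForm_sub_le {N : ℕ} (hN : 0 < N) (w p : Fin N → Fin N → ℝ)
    (hw : ∀ i j, 0 ≤ w i j) (hws : ∀ i j, w i j = w j i) {pbar Δ κ k η ρ : ℝ}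
    (hp : ∀ i j, 0 ≤ p i j) (hpb : ∀ i j, p i j ≤ pbar)
    (hdeg : ∀ i, ∑ j, w i j ≤ Δ)
    (hcut : ∀ s t : Fin N → Bool, ∑ i, ∑ j, signOf (s i) * signOf (t j) * (w i j - p i j) ≤ κ * N)
    (hη : 0 < η) (hη1 : η ≤ 1) (hρ : 0 < ρ) (hk : 0 ≤ k)
    (hdens : ∀ U : Finset (Fin N), (η * ρ) ^ 2 * U.card ≤ N →
      ∑ i ∈ U, ∑ j ∈ U, w i j ≤ k * U.card) (z : Fin N → ℝ) :
    |∑ i, ∑ j, (w i j - p i j) * (z i * z j)| ≤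
      (ρ ^ 2 * κ + 2 * pbar * N / ρ + 2 * η * Δ + k / η) * ∑ i, z i ^ 2 := by
  have hN' : (0 : ℝ) < N := by exact_mod_cast hN
  set S := ∑ i, z i ^ 2 with hS
  have hS0 : 0 ≤ S := Finset.sum_nonneg fun i _ => sq_nonneg _
  rcases hS0.eq_or_lt with hS00 | hSpos
  · have hz : ∀ i, z i = 0 := fun i => by
      have := (Finset.sum_eq_zero_iff_of_nonneg (fun i _ => sq_nonneg (z i))).mp hS00.symm i
        (Finset.mem_univ i)
      exact pow_eq_zero_iff two_ne_zero |>.mp this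
    simp [hz, ← hS00]
  -- `q` is the root mean square of the coordinates. A coordinate counts as small up to `a = ρ q`,
  -- so that the cut norm contributes `a² κ N = ρ² κ S`.
  set q := √(S / N) with hq
  have hqpos : 0 < q := Real.sqrt_pos.mpr (by positivity)
  have hq2 : q ^ 2 * N = S := by
    rw [hq, Real.sq_sqrt (by positivity)]; field_simp
  set a := ρ * q with ha
  have hapos : 0 < a := by positivity
  have hpbar : 0 ≤ pbar := (hp ⟨0, hN⟩ ⟨0, hN⟩).trans (hpb ⟨0, hN⟩ ⟨0, hN⟩)
  set zs : Fin N → ℝ := fun i => if |z i| ≤ a then z i else 0 with hzs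
  have hzsa : ∀ i, |zs i| ≤ a := by
    intro i
    simp only [hzs]
    split_ifs with h
    · exact h
    · simpa using hapos.le
  set g : Fin N → ℝ := fun i => if |z i| ≤ a then 0 else |z i| with hg
  have hg0 : ∀ i, 0 ≤ g i := fun i => by simp only [hg]; split_ifs <;> positivity
  set b : Fin N → ℝ := fun i => if η * a < |z i| then z i ^ 2 else 0 with hb
  have hb0 : ∀ i, 0 ≤ b i := fun i => by simp only [hb]; split_ifs <;> positivity
  have hbz : ∀ i, b i ≤ z i ^ 2 := fun i => by
    simp only [hb]; split_ifs
    · rfl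
    · positivity
  set H : Finset (Fin N) := Finset.univ.filter fun i => η * a < |z i| with hH
  -- the part of the form on pairs of small coordinates
  have hsmall : |∑ i, ∑ j, (w i j - p i j) * (zs i * zs j)| ≤ ρ ^ 2 * κ * S := by
    have e : a ^ 2 * (κ * N) = ρ ^ 2 * κ * S := by rw [← hq2, ha]; ring
    rw [abs_le']
    constructor
    · rw [← e]
      exact bilinear_le_of_signs _ _ a hapos.le hcut zs zs hzsa hzsa
    · rw [← e]
      have := bilinear_le_of_signs _ _ a hapos.le hcut zs (fun i => - zs i) hzsa
        (fun i => by rw [abs_neg]; exact hzsa i)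
      refine le_of_eq_of_le ?_ this
      rw [← Finset.sum_neg_distrib]
      refine Finset.sum_congr rfl fun i _ => ?_
      rw [← Finset.sum_neg_distrib]
      exact Finset.sum_congr rfl fun j _ => by ring
  have hsplit : ∀ i j, |(w i j - p i j) * (z i * z j) - (w i j - p i j) * (zs i * zs j)| ≤
      w i j * (η * (z i ^ 2 + z j ^ 2) + min (b i) (b j) / η) +
        pbar * (g i * |z j| + |z i| * g j) := by
    intro i j
    have hn1 : 0 ≤ pbar * (g i * |z j| + |z i| * g j) :=
      mul_nonneg hpbar (add_nonneg (mul_nonneg (hg0 i) (abs_nonneg _))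
        (mul_nonneg (abs_nonneg _) (hg0 j)))
    have hn2 : 0 ≤ w i j * (η * (z i ^ 2 + z j ^ 2) + min (b i) (b j) / η) :=
      mul_nonneg (hw i j) (add_nonneg (by positivity)
        (div_nonneg (le_min (hb0 i) (hb0 j)) hη.le))
    by_cases hij : |z i| ≤ a ∧ |z j| ≤ a
    · simp only [hzs, if_pos hij.1, if_pos hij.2, sub_self, abs_zero]
      linarith
    · have hzz : zs i * zs j = 0 := by
        rw [not_and_or] at hij
        rcases hij with h | h
        · simp [hzs, h]
        · simp [hzs, h]
      rw [hzz, mul_zero, sub_zero, abs_mul, abs_mul]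
      -- Two bounds for the same product: the first is used against `w`, where degrees and densities
      -- are controlled, the second against the mean, which is uniformly small.
      have h1 : |z i| * |z j| ≤ η * (z i ^ 2 + z j ^ 2) + min (b i) (b j) / η := by
        apply abs_mul_abs_le hη hη1 hapos
        rw [not_and_or, not_le, not_le] at hij
        exact hij
      have h2 : |z i| * |z j| ≤ g i * |z j| + |z i| * g j := by
        have ha1 := mul_nonneg (hg0 i) (abs_nonneg (z j))
        have ha2 := mul_nonneg (abs_nonneg (z i)) (hg0 j)
        rw [not_and_or] at hij
        rcases hij with h | h
        · have : g i = |z i| := by simp [hg, h]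
          rw [this] at ha1 ⊢; linarith
        · have : g j = |z j| := by simp [hg, h]
          rw [this] at ha2 ⊢; linarith
      have h3 : |w i j - p i j| ≤ w i j + pbar := by
        rw [abs_le]; constructor <;> linarith [hw i j, hp i j, hpb i j]
      have h4 : 0 ≤ |z i| * |z j| := by positivity
      calc |w i j - p i j| * (|z i| * |z j|) ≤ (w i j + pbar) * (|z i| * |z j|) := by gcongr
        _ = w i j * (|z i| * |z j|) + pbar * (|z i| * |z j|) := by ring
        _ ≤ _ := add_le_add (mul_le_mul_of_nonneg_left h1 (hw i j))
            (mul_le_mul_of_nonneg_left h2 hpbar)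
  -- summation of the bounds
  have hsumz : ∑ i, |z i| ≤ N * q := by
    have h1 : (∑ i, |z i|) ^ 2 ≤ (N * q) ^ 2 := by
      have := sq_sum_le_card_mul_sum_sq (s := Finset.univ) (f := fun i => |z i|)
      simp only [sq_abs, Finset.card_univ, Fintype.card_fin] at this
      calc _ ≤ N * S := this
        _ = _ := by rw [← hq2]; ring
    exact (abs_le_of_sq_le_sq' h1 (by positivity)).2
  have hsumg : ∑ i, g i ≤ S / a := by
    rw [hS, Finset.sum_div]
    refine Finset.sum_le_sum fun i _ => ?_
    simp only [hg]
    split_ifs with h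
    · positivity
    · rw [le_div_iff₀ hapos, ← sq_abs]
      push Not at h
      nlinarith
  have hP : ∑ i, ∑ j, pbar * (g i * |z j| + |z i| * g j) ≤ 2 * pbar * N / ρ * S := by
    have e : ∑ i, ∑ j, pbar * (g i * |z j| + |z i| * g j) =
        2 * pbar * ((∑ i, g i) * ∑ j, |z j|) := by
      simp only [← Finset.mul_sum, Finset.sum_add_distrib, ← Finset.sum_mul]
      ring
    rw [e]
    have : (∑ i, g i) * ∑ j, |z j| ≤ S / a * (N * q) :=
      mul_le_mul hsumg hsumz (Finset.sum_nonneg fun _ _ => abs_nonneg _) (by positivity)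
    calc 2 * pbar * ((∑ i, g i) * ∑ j, |z j|) ≤ 2 * pbar * (S / a * (N * q)) := by gcongr
      _ = _ := by rw [ha]; field_simp
  have hD : ∑ i, ∑ j, w i j * (η * (z i ^ 2 + z j ^ 2)) ≤ 2 * η * Δ * S := by
    have e1 : ∑ i, ∑ j, w i j * z i ^ 2 ≤ Δ * S := by
      rw [hS, Finset.mul_sum]
      refine Finset.sum_le_sum fun i _ => ?_
      rw [← Finset.sum_mul]
      exact mul_le_mul_of_nonneg_right (hdeg i) (sq_nonneg _)
    have e2 : ∑ i, ∑ j, w i j * z j ^ 2 = ∑ i, ∑ j, w i j * z i ^ 2 := by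
      rw [Finset.sum_comm]
      exact Finset.sum_congr rfl fun i _ => Finset.sum_congr rfl fun j _ => by rw [hws]
    have e3 : ∑ i, ∑ j, w i j * (η * (z i ^ 2 + z j ^ 2)) =
        η * (∑ i, ∑ j, w i j * z i ^ 2 + ∑ i, ∑ j, w i j * z j ^ 2) := by
      simp only [← Finset.sum_add_distrib, Finset.mul_sum]
      exact Finset.sum_congr rfl fun i _ => Finset.sum_congr rfl fun j _ => by ring
    rw [e3, e2]
    nlinarith
  -- Markov's inequality for the squares: few coordinates exceed `η * ρ` times the root mean square,
  -- so the density hypothesis covers every subset of `H`.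
  have hHcard : (η * ρ) ^ 2 * H.card ≤ N := by
    have h1 : ∑ i ∈ H, (η * a) ^ 2 ≤ S := by
      calc ∑ i ∈ H, (η * a) ^ 2 ≤ ∑ i ∈ H, z i ^ 2 := by
            refine Finset.sum_le_sum fun i hi => ?_
            rw [← sq_abs (z i)]
            have : η * a < |z i| := (Finset.mem_filter.mp hi).2
            gcongr
        _ ≤ S := Finset.sum_le_sum_of_subset_of_nonneg (Finset.subset_univ _)
            fun _ _ _ => sq_nonneg _
    rw [Finset.sum_const, nsmul_eq_mul, ← hq2, ha] at h1
    have : q ^ 2 * ((η * ρ) ^ 2 * H.card) ≤ q ^ 2 * N := by nlinarith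
    exact le_of_mul_le_mul_left this (by positivity)
  have hM : ∑ i, ∑ j, w i j * (min (b i) (b j) / η) ≤ k / η * S := by
    have h1 := sum_min_le_of_density w k H b (fun i _ => hb0 i) (fun U hU => hdens U (by
      have : (U.card : ℝ) ≤ H.card := by exact_mod_cast Finset.card_le_card hU
      calc (η * ρ) ^ 2 * U.card ≤ (η * ρ) ^ 2 * H.card := by gcongr
        _ ≤ (N : ℝ) := hHcard))
    have hbH : ∀ i ∉ H, b i = 0 := fun i hi => by
      simp only [hH, Finset.mem_filter, Finset.mem_univ, true_and] at hi
      simp [hb, hi]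
    have h2 : ∑ i, ∑ j, w i j * min (b i) (b j) = ∑ i ∈ H, ∑ j ∈ H, w i j * min (b i) (b j) := by
      symm
      rw [← Finset.sum_subset (Finset.subset_univ H)
        (f := fun i => ∑ j, w i j * min (b i) (b j))]
      · refine Finset.sum_congr rfl fun i _ => ?_
        refine Finset.sum_subset (Finset.subset_univ H) fun j _ hj => ?_
        rw [hbH j hj, min_eq_right (hb0 i), mul_zero]
      · intro i _ hi
        refine Finset.sum_eq_zero fun j _ => ?_
        rw [hbH i hi, min_eq_left (hb0 j), mul_zero]
    have h3 : ∑ i ∈ H, b i ≤ S := by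
      calc ∑ i ∈ H, b i ≤ ∑ i ∈ H, z i ^ 2 := Finset.sum_le_sum fun i _ => hbz i
        _ ≤ S := Finset.sum_le_sum_of_subset_of_nonneg (Finset.subset_univ _)
            fun _ _ _ => sq_nonneg _
    have h4 : ∑ i, ∑ j, w i j * (min (b i) (b j) / η) =
        (∑ i, ∑ j, w i j * min (b i) (b j)) / η := by
      simp only [Finset.sum_div]
      exact Finset.sum_congr rfl fun i _ => Finset.sum_congr rfl fun j _ => by ring
    rw [h4, h2, div_mul_eq_mul_div]
    gcongr
    exact h1.trans (by gcongr)
  have hrest : |∑ i, ∑ j, (w i j - p i j) * (z i * z j) -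
      ∑ i, ∑ j, (w i j - p i j) * (zs i * zs j)| ≤
      (2 * pbar * N / ρ + 2 * η * Δ + k / η) * S := by
    simp only [← Finset.sum_sub_distrib]
    calc _ ≤ ∑ i, ∑ j, |(w i j - p i j) * (z i * z j) - (w i j - p i j) * (zs i * zs j)| :=
          (Finset.abs_sum_le_sum_abs _ _).trans
            (Finset.sum_le_sum fun i _ => Finset.abs_sum_le_sum_abs _ _)
      _ ≤ ∑ i, ∑ j, (w i j * (η * (z i ^ 2 + z j ^ 2) + min (b i) (b j) / η) +
        pbar * (g i * |z j| + |z i| * g j)) :=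
          Finset.sum_le_sum fun i _ => Finset.sum_le_sum fun j _ => hsplit i j
      _ = ∑ i, ∑ j, w i j * (η * (z i ^ 2 + z j ^ 2)) +
          ∑ i, ∑ j, w i j * (min (b i) (b j) / η) +
          ∑ i, ∑ j, pbar * (g i * |z j| + |z i| * g j) := by
          simp only [← Finset.sum_add_distrib]
          exact Finset.sum_congr rfl fun i _ => Finset.sum_congr rfl fun j _ => by ring
      _ ≤ _ := by linarith
  have := abs_sub_abs_le_abs_sub (∑ i, ∑ j, (w i j - p i j) * (z i * z j))
    (∑ i, ∑ j, (w i j - p i j) * (zs i * zs j))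
  linarith


/-! ### Counting node sets by community profile -/

lemma sum_choose_mul_choose_ite (p q t : ℕ) (h : ℕ → ℕ → ℝ) :
    ∑ a ∈ Finset.range (p + 1), ∑ b ∈ Finset.range (q + 1),
      (p.choose a : ℝ) * ((q.choose b : ℝ) * (if a + b = t then h a b else 0)) =
    ∑ x ∈ Finset.HasAntidiagonal.antidiagonal t, (p.choose x.1 : ℝ) * (q.choose x.2) * h x.1 x.2 := by
  rw [← Finset.sum_product']
  have : ∀ x : ℕ × ℕ, (p.choose x.1 : ℝ) * ((q.choose x.2 : ℝ) *
      (if x.1 + x.2 = t then h x.1 x.2 else 0)) =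
      if x.1 + x.2 = t then (p.choose x.1 : ℝ) * (q.choose x.2) * h x.1 x.2 else 0 := by
    intro x; split_ifs <;> ring
  simp only [this]
  rw [← Finset.sum_filter]
  -- Pairs of the antidiagonal outside the rectangle have a vanishing binomial coefficient.
  refine Finset.sum_subset (fun x hx => ?_) (fun x hx hx' => ?_)
  · simpa using (Finset.mem_filter.mp hx).2
  · rw [Finset.HasAntidiagonal.mem_antidiagonal] at hx
    simp only [Finset.mem_filter, Finset.mem_product, Finset.mem_range, hx, and_true,
      not_and_or, not_lt] at hx'
    rcases hx' with h1 | h1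
    · rw [Nat.choose_eq_zero_of_lt h1]; simp
    · rw [Nat.choose_eq_zero_of_lt h1]; simp

/-- The nodes with a given sign. -/
def community {N : ℕ} (σ : Fin N → ℤ) (k : ℤ) : Finset (Fin N) :=
  Finset.univ.filter fun i => σ i = k

lemma filter_eq_inter_community {N : ℕ} (σ : Fin N → ℤ) (k : ℤ) (e : Finset (Fin N)) :
    e.filter (fun i => σ i = k) = e ∩ community σ k := by
  ext i; simp [community]

lemma profile_sum {N : ℕ} {σ : Fin N → ℤ} (hσ : ∀ i, σ i = 1 ∨ σ i = -1)
    (e : Finset (Fin N)) : (profile σ e).1 + (profile σ e).2 = e.card := by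
  simp only [profile]
  rw [← Finset.card_union_of_disjoint]
  · congr 1
    ext i
    have := hσ i
    simp only [Finset.mem_union, Finset.mem_filter]
    tauto
  · rw [Finset.disjoint_left]
    intro i hi hj
    have h1 := (Finset.mem_filter.mp hi).2
    have h2 := (Finset.mem_filter.mp hj).2
    omega

/-- Summation of a function of the community profile over the node sets of given size which
contain a given node set. -/
lemma sum_superset_profile {N : ℕ} {σ : Fin N → ℤ} (hσ : ∀ i, σ i = 1 ∨ σ i = -1)
    (K : Finset (Fin N)) {d : ℕ} (hd : K.card ≤ d) (g : ℕ × ℕ → ℝ) :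
    ∑ e : {e : Finset (Fin N) // e.card = d}, (if K ⊆ e.1 then g (profile σ e.1) else 0) =
    ∑ x ∈ Finset.HasAntidiagonal.antidiagonal (d - K.card),
      ((community σ (-1) \ K).card.choose x.1 : ℝ) * ((community σ 1 \ K).card.choose x.2) *
        g (x.1 + (K ∩ community σ (-1)).card, x.2 + (K ∩ community σ 1).card) := by
  set P := community σ (-1) with hP
  set Q := community σ 1 with hQ
  have hPQ : Disjoint P Q := by
    rw [Finset.disjoint_left]
    intro i hi hj
    have h1 : σ i = -1 := by simpa [hP, community] using hi
    have h2 : σ i = 1 := by simpa [hQ, community] using hj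
    omega
  have hu : ∀ i, i ∈ P ∨ i ∈ Q := fun i => by
    simp only [hP, hQ, community, Finset.mem_filter, Finset.mem_univ, true_and]
    exact (hσ i).symm
  have hnot : ∀ i, i ∈ P → i ∉ Q := fun i hi hj => Finset.disjoint_left.mp hPQ hi hj
  have hK : (K ∩ P).card + (K ∩ Q).card = K.card := by
    have := profile_sum hσ K
    simpa only [profile, filter_eq_inter_community] using this
  set p' : ℕ := (K ∩ P).card with hp'
  set q' : ℕ := (K ∩ Q).card with hq'
  have e1 : ∑ e : {e : Finset (Fin N) // e.card = d}, (if K ⊆ e.1 then g (profile σ e.1) else 0) =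
      ∑ e ∈ Finset.univ.filter (fun e : Finset (Fin N) => K ⊆ e),
        if (profile σ e).1 + (profile σ e).2 = d then g (profile σ e) else 0 := by
    rw [← Finset.sum_subtype (Finset.univ.filter fun e : Finset (Fin N) => e.card = d) (by simp)
      (fun e => if K ⊆ e then g (profile σ e) else 0), Finset.sum_filter, Finset.sum_filter]
    refine Finset.sum_congr rfl fun e _ => ?_
    rw [profile_sum hσ]
    split_ifs <;> rfl
  -- A set containing `K` is determined by its members outside `K` in either community, which may be
  -- chosen freely.
  have e2 : ∑ e ∈ Finset.univ.filter (fun e : Finset (Fin N) => K ⊆ e),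
        (if (profile σ e).1 + (profile σ e).2 = d then g (profile σ e) else 0) =
      ∑ x ∈ (P \ K).powerset ×ˢ (Q \ K).powerset,
        if x.1.card + x.2.card = d - K.card then g (x.1.card + p', x.2.card + q') else 0 := by
    refine Finset.sum_bij' (fun e _ => ((e ∩ P) \ K, (e ∩ Q) \ K)) (fun x _ => K ∪ x.1 ∪ x.2)
      ?_ ?_ ?_ ?_ ?_
    · intro e _
      simp only [Finset.mem_product, Finset.mem_powerset]
      exact ⟨Finset.sdiff_subset_sdiff Finset.inter_subset_right subset_rfl,
        Finset.sdiff_subset_sdiff Finset.inter_subset_right subset_rfl⟩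
    · intro x _
      simp only [Finset.mem_filter, Finset.mem_univ, true_and, Finset.union_assoc]
      exact Finset.subset_union_left
    · intro e he
      have he' : K ⊆ e := (Finset.mem_filter.mp he).2
      ext i
      have h1 := hu i
      have h2 := @he' i
      simp only [Finset.mem_union, Finset.mem_sdiff, Finset.mem_inter]
      tauto
    · rintro ⟨x, y⟩ hxy
      simp only [Finset.mem_product, Finset.mem_powerset] at hxy
      ext i
      · have h1 := @hxy.1 i
        have h2 := @hxy.2 i
        have h3 := hnot i
        simp only [Finset.mem_union, Finset.mem_sdiff, Finset.mem_inter] at h1 h2 ⊢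
        tauto
      · have h1 := @hxy.1 i
        have h2 := @hxy.2 i
        have h3 := hnot i
        simp only [Finset.mem_union, Finset.mem_sdiff, Finset.mem_inter] at h1 h2 ⊢
        tauto
    · intro e he
      have he' : K ⊆ e := (Finset.mem_filter.mp he).2
      have hc : ∀ R : Finset (Fin N), (e ∩ R).card = ((e ∩ R) \ K).card + (K ∩ R).card := by
        intro R
        have h0 : e ∩ R ∩ K = K ∩ R := by
          ext i
          have h2 := @he' i
          simp only [Finset.mem_inter]
          tauto
        rw [← Finset.card_sdiff_add_card_inter (e ∩ R) K, h0]
      simp only [profile, filter_eq_inter_community]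
      rw [← hP, ← hQ, hc P, hc Q]
      have : ((e ∩ P) \ K).card + (K ∩ P).card + (((e ∩ Q) \ K).card + (K ∩ Q).card) = d ↔
        ((e ∩ P) \ K).card + ((e ∩ Q) \ K).card = d - K.card := by omega
      simp only [this, hp', hq']
  rw [e1, e2, Finset.sum_product]
  rw [Finset.sum_powerset_apply_card (fun a => ∑ y ∈ (Q \ K).powerset,
    if a + y.card = d - K.card then g (a + p', y.card + q') else 0)]
  rw [← sum_choose_mul_choose_ite _ _ _ (fun a b => g (a + p', b + q'))]
  refine Finset.sum_congr rfl fun a _ => ?_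
  rw [Finset.sum_powerset_apply_card (fun b =>
    if a + b = d - K.card then g (a + p', b + q') else 0), nsmul_eq_mul, Finset.mul_sum]
  refine Finset.sum_congr rfl fun b _ => ?_
  rw [nsmul_eq_mul]

/-- The profile count with all nodes placed in one community, where Vandermonde's sum reduces to a
single term. -/
lemma sum_superset_one {N : ℕ} (K : Finset (Fin N)) {d : ℕ} (hd : K.card ≤ d) :
    ∑ e : {e : Finset (Fin N) // e.card = d}, (if K ⊆ e.1 then (1 : ℝ) else 0) =
      ((N - K.card).choose (d - K.card) : ℝ) := by
  have h := sum_superset_profile (σ := fun _ : Fin N => 1) (by simp) K hd (fun _ => 1)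
  rw [h]
  have h1 : community (fun _ : Fin N => (1 : ℤ)) (-1) = ∅ := by
    ext; simp [community]
  have h2 : community (fun _ : Fin N => (1 : ℤ)) 1 = Finset.univ := by
    ext; simp [community]
  rw [h1, h2]
  have h3 : (Finset.univ \ K).card = N - K.card := by
    rw [Finset.card_univ_sdiff, Fintype.card_fin]
  rw [h3]
  have h4 := Nat.add_choose_eq 0 (N - K.card) (d - K.card)
  rw [zero_add] at h4
  rw [h4]
  simp

/-! ### Hyperedge probabilities and the mean similarity matrix -/

section Model

variable {M N : ℕ} {d : Fin M → ℕ} {α : Fin M → ℕ × ℕ → ℝ} {σ : Fin N → ℤ}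

/-- The indicator that two distinct nodes both lie in a hyperedge slot. -/
noncomputable def incidence (q : Slot N d) (i j : Fin N) : ℝ :=
  if i ≠ j ∧ i ∈ q.2.1 ∧ j ∈ q.2.1 then 1 else 0

/-- The real number attached to a truth value. -/
def indic (b : Bool) : ℝ := if b then 1 else 0

/-- The probability of a hyperedge slot. -/
noncomputable def prob (d : Fin M → ℕ) (α : Fin M → ℕ × ℕ → ℝ) (σ : Fin N → ℤ)
    (q : Slot N d) : ℝ :=
  edgeProb N (d q.1) (α q.1 (profile σ q.2.1))

/-- The conditional mean of the similarity matrix. -/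
noncomputable def meanSimilarity (d : Fin M → ℕ) (α : Fin M → ℕ × ℕ → ℝ) (σ : Fin N → ℤ)
    (i j : Fin N) : ℝ :=
  ∑ q : Slot N d, incidence q i j * prob d α σ q

lemma similarity_apply (A : Hypergraph N d) (i j : Fin N) :
    similarity A i j = ∑ q : Slot N d, incidence q i j * indic (A q) := by
  rw [Fintype.sum_sigma]
  simp only [similarity, Matrix.sum_apply, layerSimilarity]
  refine Finset.sum_congr rfl fun m _ => ?_
  by_cases h : i = j
  · simp [h, incidence]
  · rw [if_neg h]
    refine Finset.sum_congr rfl fun e _ => ?_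
    simp only [incidence, indic]
    by_cases h1 : i ∈ e.1 <;> by_cases h2 : j ∈ e.1 <;> simp [h, h1, h2]

lemma incidence_comm (q : Slot N d) (i j : Fin N) : incidence q i j = incidence q j i := by
  simp only [incidence]
  congr 1
  rw [ne_comm, and_comm (a := i ∈ _)]

lemma incidence_nonneg (q : Slot N d) (i j : Fin N) : 0 ≤ incidence q i j := by
  unfold incidence; split_ifs <;> norm_num

lemma incidence_self (q : Slot N d) (i : Fin N) : incidence q i i = 0 := by
  simp [incidence]

lemma indic_nonneg (b : Bool) : 0 ≤ indic b := by unfold indic; split_ifs <;> norm_num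

lemma similarity_comm (A : Hypergraph N d) (i j : Fin N) :
    similarity A i j = similarity A j i := by
  simp only [similarity_apply, incidence_comm]

lemma similarity_self (A : Hypergraph N d) (i : Fin N) : similarity A i i = 0 := by
  simp [similarity_apply, incidence_self]

lemma similarity_nonneg (A : Hypergraph N d) (i j : Fin N) : 0 ≤ similarity A i j := by
  rw [similarity_apply]
  exact Finset.sum_nonneg fun q _ => mul_nonneg (incidence_nonneg q i j) (indic_nonneg _)

lemma profile_eq (hσ : ∀ i, σ i = 1 ∨ σ i = -1) (q : Slot N d) :
    ∃ r ≤ d q.1, profile σ q.2.1 = (r, d q.1 - r) := by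
  have := profile_sum hσ q.2.1
  rw [q.2.2] at this
  exact ⟨(profile σ q.2.1).1, by omega, Prod.ext rfl (by simp; omega)⟩

/-- Standing bounds on the parameters of the model. -/
structure Bounds (d : Fin M → ℕ) (α : Fin M → ℕ × ℕ → ℝ) (a D : ℝ) : Prop where
  pos : ∀ m, ∀ r ≤ d m, 0 < α m (r, d m - r)
  le : ∀ m, ∀ r ≤ d m, α m (r, d m - r) ≤ a
  a_pos : 0 < a
  two_le : ∀ m, 2 ≤ d m
  d_le : ∀ m, (d m : ℝ) ≤ D
  one_le : 1 ≤ D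

lemma exists_bounds (hd : ∀ m, 2 ≤ d m) (hα : ∀ m, ∀ r ≤ d m, 0 < α m (r, d m - r)) :
    ∃ a D, Bounds d α a D := by
  refine ⟨1 + ∑ m, ∑ r ∈ Finset.range (d m + 1), α m (r, d m - r), 1 + ∑ m, (d m : ℝ), ?_⟩
  have h0 : ∀ m, ∀ r ∈ Finset.range (d m + 1), 0 ≤ α m (r, d m - r) := fun m r hr =>
    (hα m r (by simpa [Nat.lt_succ_iff] using hr)).le
  have h1 : ∀ m, 0 ≤ ∑ r ∈ Finset.range (d m + 1), α m (r, d m - r) := fun m =>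
    Finset.sum_nonneg (h0 m)
  have h2 : 0 ≤ ∑ m, ∑ r ∈ Finset.range (d m + 1), α m (r, d m - r) :=
    Finset.sum_nonneg fun m _ => h1 m
  have h3 : 0 ≤ ∑ m, (d m : ℝ) := Finset.sum_nonneg fun m _ => by positivity
  refine ⟨hα, fun m r hr => ?_, by linarith, hd, fun m => ?_, by linarith⟩
  · have h4 := Finset.single_le_sum (h0 m)
      (show r ∈ Finset.range (d m + 1) by simpa [Nat.lt_succ_iff] using hr)
    have h5 := Finset.single_le_sum (fun m _ => h1 m) (Finset.mem_univ m)
    linarith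
  · have := Finset.single_le_sum (f := fun m => (d m : ℝ)) (fun m _ => by positivity)
      (Finset.mem_univ m)
    linarith

variable {a D : ℝ}

lemma Bounds.prob_nonneg (h : Bounds d α a D) (hσ : ∀ i, σ i = 1 ∨ σ i = -1) (q : Slot N d) :
    0 ≤ prob d α σ q := by
  obtain ⟨r, hr, hq⟩ := profile_eq hσ q
  unfold prob edgeProb
  rw [hq]
  have := h.pos q.1 r hr
  have := Real.log_natCast_nonneg N
  exact le_min (by positivity) zero_le_one

lemma prob_le_one (q : Slot N d) : prob d α σ q ≤ 1 := min_le_right _ _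

lemma Bounds.prob_le (h : Bounds d α a D) (hσ : ∀ i, σ i = 1 ∨ σ i = -1) (q : Slot N d) :
    prob d α σ q ≤ a * Real.log N / ((N - 1).choose (d q.1 - 1) : ℝ) := by
  obtain ⟨r, hr, hq⟩ := profile_eq hσ q
  unfold prob edgeProb
  rw [hq]
  refine (min_le_left _ _).trans ?_
  have := h.le q.1 r hr
  have := Real.log_natCast_nonneg N
  gcongr

/-- The expected number of hyperedges at a node is logarithmic. -/
lemma Bounds.sum_prob_node_le (h : Bounds d α a D) (hσ : ∀ i, σ i = 1 ∨ σ i = -1) (i : Fin N) :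
    ∑ q : Slot N d, (if i ∈ q.2.1 then prob d α σ q else 0) ≤ M * (a * Real.log N) := by
  have hl := Real.log_natCast_nonneg N
  have ha := h.a_pos
  rw [Fintype.sum_sigma]
  have : ∀ m : Fin M, ∑ e : {e : Finset (Fin N) // e.card = d m},
      (if i ∈ e.1 then prob d α σ ⟨m, e⟩ else 0) ≤ a * Real.log N := by
    intro m
    have h2 := h.two_le m
    have hc := sum_superset_one ({i} : Finset (Fin N)) (d := d m) (by simp; omega)
    simp only [Finset.singleton_subset_iff, Finset.card_singleton] at hc
    set C : ℝ := ((N - 1).choose (d m - 1) : ℝ) with hC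
    calc _ ≤ ∑ e : {e : Finset (Fin N) // e.card = d m},
          a * Real.log N / C * (if i ∈ e.1 then 1 else 0) := by
          refine Finset.sum_le_sum fun e _ => ?_
          split_ifs
          · rw [mul_one]; exact h.prob_le hσ ⟨m, e⟩
          · simp
      _ = a * Real.log N / C * C := by rw [← Finset.mul_sum, hc]
      _ ≤ a * Real.log N := by
          have : 0 ≤ a * Real.log N := by positivity
          -- `C = 0` occurs when `d m > N`; the quotient by it is then `0` by convention and the
          -- bound is trivial.
          rcases (show 0 ≤ C by positivity).eq_or_lt with h0 | h0
          · rw [← h0]; simpa using this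
          · rw [div_mul_cancel₀ _ h0.ne']
  calc _ ≤ ∑ _m : Fin M, a * Real.log N := Finset.sum_le_sum fun m _ => this m
    _ = _ := by simp

/-- The entries of the mean similarity matrix are of order `log N / N`. -/
lemma Bounds.meanSimilarity_le (h : Bounds d α a D) (hσ : ∀ i, σ i = 1 ∨ σ i = -1)
    (hN : 2 ≤ N) (i j : Fin N) :
    meanSimilarity d α σ i j ≤ 2 * M * a * D * Real.log N / N := by
  have hl := Real.log_natCast_nonneg N
  have ha := h.a_pos
  have hD := h.one_le
  have hN' : (2 : ℝ) ≤ N := by exact_mod_cast hN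
  unfold meanSimilarity
  by_cases hij : i = j
  · subst hij
    simp only [incidence_self, zero_mul, Finset.sum_const_zero]
    positivity
  rw [Fintype.sum_sigma]
  have : ∀ m : Fin M, ∑ e : {e : Finset (Fin N) // e.card = d m},
      incidence (d := d) ⟨m, e⟩ i j * prob d α σ ⟨m, e⟩ ≤ 2 * a * D * Real.log N / N := by
    intro m
    have h2 := h.two_le m
    have hc := sum_superset_one ({i, j} : Finset (Fin N)) (d := d m)
      (by rw [Finset.card_pair hij]; omega)
    simp only [Finset.insert_subset_iff, Finset.singleton_subset_iff,
      Finset.card_pair hij] at hc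
    set C : ℝ := ((N - 1).choose (d m - 1) : ℝ) with hC
    have hC0 : 0 ≤ C := by positivity
    have hch : ((N - 2).choose (d m - 2) : ℝ) * (N - 1) = C * ((d m : ℝ) - 1) := by
      obtain ⟨n, rfl⟩ : ∃ n, N = n + 2 := ⟨N - 2, by omega⟩
      obtain ⟨k, hk⟩ : ∃ k, d m = k + 2 := ⟨d m - 2, by omega⟩
      have := Nat.add_one_mul_choose_eq n k
      rw [hC, hk]
      have h3 : n + 2 - 1 = n + 1 := rfl
      have h4 : k + 2 - 1 = k + 1 := rfl
      rw [h3, h4, Nat.add_sub_cancel, Nat.add_sub_cancel]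
      have h5 : ((n + 1 : ℕ) : ℝ) * (n.choose k) = ((n + 1).choose (k + 1)) * ((k + 1 : ℕ) : ℝ) := by
        exact_mod_cast this
      push_cast at h5 ⊢
      linarith
    calc _ ≤ ∑ e : {e : Finset (Fin N) // e.card = d m},
          a * Real.log N / C * (if i ∈ e.1 ∧ j ∈ e.1 then 1 else 0) := by
          refine Finset.sum_le_sum fun e _ => ?_
          simp only [incidence, ne_eq, hij, not_false_eq_true, true_and]
          split_ifs
          · rw [mul_one, one_mul]; exact h.prob_le hσ ⟨m, e⟩
          · simp
      _ = a * Real.log N / C * ((N - 2).choose (d m - 2)) := by rw [← Finset.mul_sum, hc]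
      _ ≤ 2 * a * D * Real.log N / N := by
          rcases hC0.eq_or_lt with h0 | h0
          · rw [← h0, div_zero, zero_mul]; positivity
          · have h1 : ((N - 2).choose (d m - 2) : ℝ) = C * ((d m : ℝ) - 1) / (N - 1) := by
              rw [eq_div_iff (by linarith)]; exact hch
            rw [h1]
            have h2 : a * Real.log N / C * (C * ((d m : ℝ) - 1) / (N - 1)) =
              a * Real.log N * (((d m : ℝ) - 1) / (N - 1)) := by field_simp
            have h3 : ((d m : ℝ) - 1) / (N - 1) ≤ 2 * D / N := by
              rw [div_le_div_iff₀ (by linarith) (by linarith)]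
              have := h.d_le m
              have hd1 : (2 : ℝ) ≤ d m := by exact_mod_cast h.two_le m
              nlinarith
            rw [h2]
            calc a * Real.log N * (((d m : ℝ) - 1) / (N - 1)) ≤ a * Real.log N * (2 * D / N) := by
                  gcongr
              _ = _ := by ring
  calc _ ≤ ∑ _m : Fin M, 2 * a * D * Real.log N / N := Finset.sum_le_sum fun m _ => this m
    _ = _ := by simp; ring

lemma Bounds.meanSimilarity_nonneg (h : Bounds d α a D) (hσ : ∀ i, σ i = 1 ∨ σ i = -1)
    (i j : Fin N) : 0 ≤ meanSimilarity d α σ i j :=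
  Finset.sum_nonneg fun q _ => mul_nonneg (incidence_nonneg q i j) (h.prob_nonneg hσ q)

end Model


/-! ### Profile counts for balanced communities; the mean on the complement of `1` and `σ` -/

lemma mem_community {N : ℕ} {σ : Fin N → ℤ} {k : ℤ} {i : Fin N} :
    i ∈ community σ k ↔ σ i = k := by simp [community]

lemma card_community {n : ℕ} {σ : Fin (2 * n) → ℤ} (hσ : σ ∈ balanced (2 * n)) :
    (community σ 1).card = n ∧ (community σ (-1)).card = n := by
  have h1 : (community σ 1).card = (community σ (-1)).card := hσ.2
  have h2 := profile_sum hσ.1 Finset.univ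
  simp only [profile, Finset.card_univ, Fintype.card_fin] at h2
  have h3 : (community σ (-1)).card + (community σ 1).card = 2 * n := h2
  omega

section Layer

variable {n : ℕ} {σ : Fin (2 * n) → ℤ} {d : ℕ}

/-- Summation over the hyperedge slots at a node: the profile is counted as seen from the node,
as (members of the opposite community, members of the same community). -/
lemma sum_node_profile (hσ : σ ∈ balanced (2 * n)) (hd : 1 ≤ d) (i : Fin (2 * n))
    (F : ℕ × ℕ → ℝ) :
    ∑ e : {e : Finset (Fin (2 * n)) // e.card = d},
      (if i ∈ e.1 then F (if σ i = 1 then profile σ e.1 else (profile σ e.1).swap) else 0) =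
    ∑ r ∈ Finset.range d, (n.choose r : ℝ) * ((n - 1).choose (d - 1 - r)) * F (r, d - r) := by
  obtain ⟨c1, c2⟩ := card_community hσ
  have hd' : d = d - 1 + 1 := by omega
  -- The shift `x.2 + 1` is the node itself, which belongs to its own community and is not among the
  -- `d - 1` chosen companions.
  have hR : ∑ r ∈ Finset.range d, (n.choose r : ℝ) * ((n - 1).choose (d - 1 - r)) * F (r, d - r) =
      ∑ x ∈ Finset.HasAntidiagonal.antidiagonal (d - 1),
        (n.choose x.1 : ℝ) * ((n - 1).choose x.2) * F (x.1, x.2 + 1) := by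
    rw [Finset.Nat.sum_antidiagonal_eq_sum_range_succ_mk]
    simp only [Nat.succ_eq_add_one]
    rw [← hd']
    refine Finset.sum_congr rfl fun r hr => ?_
    have : d - 1 - r + 1 = d - r := by have := Finset.mem_range.mp hr; omega
    rw [this]
  rw [hR]
  have hK : ({i} : Finset (Fin (2 * n))).card ≤ d := by simpa using hd
  rcases hσ.1 i with h | h
  · have key := sum_superset_profile hσ.1 {i} hK F
    simp only [Finset.singleton_subset_iff, Finset.card_singleton] at key
    simp only [h, if_true]
    rw [key]
    have s1 : community σ (-1) \ {i} = community σ (-1) :=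
      Finset.sdiff_eq_self_of_disjoint (by simp [mem_community, h])
    have s2 : ({i} : Finset (Fin (2 * n))) ∩ community σ (-1) = ∅ :=
      Finset.singleton_inter_of_notMem (by simp [mem_community, h])
    have s3 : ({i} : Finset (Fin (2 * n))) ∩ community σ 1 = {i} :=
      Finset.singleton_inter_of_mem (by simp [mem_community, h])
    have s4 : (community σ 1 \ {i}).card = n - 1 := by
      rw [Finset.card_sdiff, s3, c1]; simp
    rw [s1, s2, s3, s4, c2]
    simp
  · have key := sum_superset_profile hσ.1 {i} hK (fun x => F x.swap)
    simp only [Finset.singleton_subset_iff, Finset.card_singleton] at key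
    have h' : ¬ (σ i = 1) := by omega
    simp only [h', if_false]
    rw [key]
    have s1 : community σ 1 \ {i} = community σ 1 :=
      Finset.sdiff_eq_self_of_disjoint (by simp [mem_community, h])
    have s2 : ({i} : Finset (Fin (2 * n))) ∩ community σ 1 = ∅ :=
      Finset.singleton_inter_of_notMem (by simp [mem_community, h])
    have s3 : ({i} : Finset (Fin (2 * n))) ∩ community σ (-1) = {i} :=
      Finset.singleton_inter_of_mem (by simp [mem_community, h])
    have s4 : (community σ (-1) \ {i}).card = n - 1 := by
      rw [Finset.card_sdiff, s3, c2]; simp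
    rw [s1, s2, s3, s4, c1, ← Finset.Nat.sum_antidiagonal_swap]
    refine Finset.sum_congr rfl fun x _ => ?_
    simp [mul_comm]

/-- Summation of a symmetric function of the profile over the hyperedge slots containing two
given nodes. -/
lemma sum_pair_profile (hσ : σ ∈ balanced (2 * n)) (hd : 2 ≤ d) {i j : Fin (2 * n)} (hij : i ≠ j)
    (g : ℕ × ℕ → ℝ) (hg : ∀ a b, a + b = d → g (a, b) = g (b, a)) :
    ∑ e : {e : Finset (Fin (2 * n)) // e.card = d},
      (if i ∈ e.1 ∧ j ∈ e.1 then g (profile σ e.1) else 0) =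
    if σ i = σ j then ∑ x ∈ Finset.HasAntidiagonal.antidiagonal (d - 2),
      (n.choose x.1 : ℝ) * ((n - 2).choose x.2) * g (x.1, x.2 + 2)
    else ∑ x ∈ Finset.HasAntidiagonal.antidiagonal (d - 2),
      ((n - 1).choose x.1 : ℝ) * ((n - 1).choose x.2) * g (x.1 + 1, x.2 + 1) := by
  obtain ⟨c1, c2⟩ := card_community hσ
  have key := sum_superset_profile hσ.1 {i, j} (d := d) (by rw [Finset.card_pair hij]; omega) g
  simp only [Finset.insert_subset_iff, Finset.singleton_subset_iff, Finset.card_pair hij] at key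
  rw [key, Finset.card_sdiff, Finset.card_sdiff, c1, c2]
  have hin : ∀ k, ({i, j} : Finset (Fin (2 * n))) ∩ community σ k =
      ({i, j} : Finset (Fin (2 * n))).filter fun l => σ l = k := fun k =>
    (filter_eq_inter_community σ k _).symm
  rw [hin, hin, Finset.filter_insert, Finset.filter_insert, Finset.filter_singleton,
    Finset.filter_singleton]
  rcases hσ.1 i with h1 | h1 <;> rcases hσ.1 j with h2 | h2
  · simp [h1, h2, Finset.card_pair hij]
  · simp [h1, h2]
  · simp [h1, h2]
  · simp only [h1, h2]
    rw [← Finset.Nat.sum_antidiagonal_swap]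
    simp only [if_true, Finset.card_pair hij, Prod.fst_swap, Prod.snd_swap]
    refine Finset.sum_congr rfl fun x hx => ?_
    have hx' := Finset.HasAntidiagonal.mem_antidiagonal.mp hx
    rw [hg (x.2 + _) _ (by simp; omega)]
    simp [mul_comm]

end Layer

section Model

variable {M n : ℕ} {d : Fin M → ℕ} {α : Fin M → ℕ × ℕ → ℝ} {σ : Fin (2 * n) → ℤ}

/-- The mean similarity matrix has two values off the diagonal. -/
lemma exists_meanSimilarity_eq (hd : ∀ m, 2 ≤ d m) (hsymm : IsSymmetric d α)
    (hσ : σ ∈ balanced (2 * n)) :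
    ∃ p q : ℝ, ∀ i j, i ≠ j → meanSimilarity d α σ i j = if σ i = σ j then p else q := by
  refine ⟨∑ m, ∑ x ∈ Finset.HasAntidiagonal.antidiagonal (d m - 2),
      (n.choose x.1 : ℝ) * ((n - 2).choose x.2) *
        edgeProb (2 * n) (d m) (α m (x.1, x.2 + 2)),
    ∑ m, ∑ x ∈ Finset.HasAntidiagonal.antidiagonal (d m - 2),
      ((n - 1).choose x.1 : ℝ) * ((n - 1).choose x.2) *
        edgeProb (2 * n) (d m) (α m (x.1 + 1, x.2 + 1)), fun i j hij => ?_⟩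
  have key := fun m => sum_pair_profile hσ (hd m) hij
    (fun x => edgeProb (2 * n) (d m) (α m x)) (fun a b hab => by
      have h1 := hsymm m a (by omega)
      have h2 : d m - a = b := by omega
      rw [h2] at h1
      simp only [h1])
  unfold meanSimilarity
  rw [Fintype.sum_sigma]
  have : ∀ m : Fin M, ∑ e : {e : Finset (Fin (2 * n)) // e.card = d m},
      incidence (d := d) ⟨m, e⟩ i j * prob d α σ ⟨m, e⟩ =
      ∑ e : {e : Finset (Fin (2 * n)) // e.card = d m},
        (if i ∈ e.1 ∧ j ∈ e.1 then edgeProb (2 * n) (d m) (α m (profile σ e.1)) else 0) := by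
    intro m
    refine Finset.sum_congr rfl fun e _ => ?_
    simp only [incidence, prob, ne_eq, hij, not_false_eq_true, true_and, ite_mul, one_mul, zero_mul]
  simp only [this, key]
  split_ifs <;> rfl

lemma exists_ne_same_sign (hσ : σ ∈ balanced (2 * n)) (hn : 2 ≤ n) :
    ∃ i j : Fin (2 * n), i ≠ j ∧ σ i = σ j := by
  have h : 1 < (community σ 1).card := by rw [(card_community hσ).1]; omega
  obtain ⟨i, hi, j, hj, hij⟩ := Finset.one_lt_card.mp h
  exact ⟨i, j, hij, (mem_community.mp hi).trans (mem_community.mp hj).symm⟩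

/-- On the orthogonal complement of the constants and `σ`, the quadratic form of the mean
similarity matrix is a negligible multiple of the identity. -/
lemma Bounds.abs_meanSimilarity_form_le {a D : ℝ} (h : Bounds d α a D) (hsymm : IsSymmetric d α)
    (hσ : σ ∈ balanced (2 * n)) (hn : 2 ≤ n) (z : Fin (2 * n) → ℝ) (hz : ∑ i, z i = 0)
    (hz' : ∑ i, (σ i : ℝ) * z i = 0) :
    |∑ i, ∑ j, meanSimilarity d α σ i j * (z i * z j)| ≤
      2 * M * a * D * Real.log (2 * n : ℕ) / (2 * n : ℕ) * ∑ i, z i ^ 2 := by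
  obtain ⟨p, q, hpq⟩ := exists_meanSimilarity_eq h.two_le hsymm hσ
  -- A combination of `1 1ᵀ` and `σ σᵀ`, both invisible to `z`, minus `p` times the identity to
  -- restore the zero diagonal.
  have hval : ∀ i j, meanSimilarity d α σ i j =
      (p + q) / 2 + (p - q) / 2 * ((σ i : ℝ) * σ j) - if i = j then p else 0 := by
    intro i j
    by_cases hij : i = j
    · subst hij
      have : meanSimilarity d α σ i i = 0 := by
        simp [meanSimilarity, incidence_self]
      rw [this, if_pos rfl, ← sq, balanced_sq hσ]; ring
    · rw [hpq i j hij, if_neg hij]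
      rcases hσ.1 i with h1 | h1 <;> rcases hσ.1 j with h2 | h2 <;> simp [h1, h2] <;> ring
  have hform : ∑ i, ∑ j, meanSimilarity d α σ i j * (z i * z j) = - (p * ∑ i, z i ^ 2) := by
    have : ∀ i, ∑ j, meanSimilarity d α σ i j * (z i * z j) =
        (p + q) / 2 * z i * ∑ j, z j + (p - q) / 2 * σ i * z i * ∑ j, (σ j : ℝ) * z j
          - p * z i ^ 2 := by
      intro i
      have e : ∑ j, (if i = j then p else 0) * (z i * z j) = p * z i ^ 2 := by
        simp [sq]
      rw [← e, Finset.mul_sum, Finset.mul_sum, ← Finset.sum_add_distrib,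
        ← Finset.sum_sub_distrib]
      exact Finset.sum_congr rfl fun j _ => by rw [hval]; ring
    simp only [this, hz, hz', mul_zero, add_zero, zero_sub, Finset.sum_neg_distrib,
      ← Finset.mul_sum]
  -- To be bounded, `p` must occur as an entry, which requires two nodes in one community.
  obtain ⟨i, j, hij, hs⟩ := exists_ne_same_sign hσ hn
  have hp : meanSimilarity d α σ i j = p := by rw [hpq i j hij, if_pos hs]
  have hp0 : 0 ≤ p := hp ▸ h.meanSimilarity_nonneg hσ.1 i j
  have hp1 := h.meanSimilarity_le hσ.1 (by omega) i j
  rw [hp] at hp1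
  have hS : 0 ≤ ∑ i, z i ^ 2 := Finset.sum_nonneg fun i _ => sq_nonneg _
  rw [hform, abs_neg, abs_of_nonneg (mul_nonneg hp0 hS)]
  exact mul_le_mul_of_nonneg_right hp1 hS

end Model


/-! ### Exponential inequality and linear statistics -/

open MeasureTheory ProbabilityTheory Filter Topology

section Chernoff

variable {M N : ℕ} {d : Fin M → ℕ} {α : Fin M → ℕ × ℕ → ℝ} {σ : Fin N → ℤ}

instance (N : ℕ) (d : Fin M → ℕ) (α : Fin M → ℕ × ℕ → ℝ) (σ : Fin N → ℤ) :
    IsProbabilityMeasure (condLaw N d α σ) := by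
  unfold condLaw; infer_instance

/-- The exponential Chebyshev inequality for linear statistics of the hypergraph. -/
lemma condLaw_chernoff (hp : ∀ q : Slot N d, 0 ≤ prob d α σ q) (f : Slot N d → ℝ) (t : ℝ) :
    (condLaw N d α σ).real {A | t ≤ ∑ q, f q * indic (A q)} ≤
      Real.exp (-t + ∑ q, prob d α σ q * (Real.exp (f q) - 1)) := by
  -- The exponential parameter is fixed at `1`, its size and sign being absorbed in `f`.
  have h1 := measure_ge_le_exp_mul_mgf (μ := condLaw N d α σ)
    (X := fun A => ∑ q, f q * indic (A q)) t zero_le_one (Integrable.of_finite)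
  have h2 : mgf (fun A => ∑ q, f q * indic (A q)) (condLaw N d α σ) 1 =
      ∏ q, (prob d α σ q * Real.exp (f q) + (1 - prob d α σ q)) := by
    simp only [mgf, one_mul, Real.exp_sum]
    unfold condLaw
    rw [integral_fintype_prod_eq_prod (f := fun q b => Real.exp (f q * indic b))]
    refine Finset.prod_congr rfl fun q _ => ?_
    rw [integral_bernoulliMeasure]
    have : ((Set.projIcc (0 : ℝ) 1 zero_le_one
        (edgeProb N (d q.1) (α q.1 (profile σ q.2.1))) : unitInterval) : ℝ) = prob d α σ q := by
      change ((Set.projIcc (0 : ℝ) 1 zero_le_one (prob d α σ q) : unitInterval) : ℝ) = _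
      rw [Set.projIcc_of_mem zero_le_one ⟨hp q, prob_le_one q⟩]
    rw [this]
    simp [indic]
  rw [h2, neg_mul, one_mul] at h1
  refine h1.trans ?_
  rw [Real.exp_add, Real.exp_sum]
  refine mul_le_mul_of_nonneg_left (Finset.prod_le_prod (fun q _ => ?_) fun q _ => ?_)
    (Real.exp_pos _).le
  · have := hp q
    have := prob_le_one (d := d) (α := α) (σ := σ) q
    have := Real.exp_pos (f q)
    have : 0 ≤ 1 - prob d α σ q := by linarith
    positivity
  · have := Real.add_one_le_exp (prob d α σ q * (Real.exp (f q) - 1))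
    linarith

end Chernoff

section Statistics

variable {M N : ℕ} {d : Fin M → ℕ}

/-- Linear statistics of the similarity matrix, as linear statistics of the hypergraph. -/
lemma sum_similarity_eq (A : Hypergraph N d) (c : Fin N → Fin N → ℝ) :
    ∑ i, ∑ j, c i j * similarity A i j =
      ∑ q, (∑ i, ∑ j, c i j * incidence q i j) * indic (A q) := by
  simp only [similarity_apply, Finset.sum_mul, Finset.mul_sum]
  symm
  rw [Finset.sum_comm]
  refine Finset.sum_congr rfl fun i _ => ?_
  rw [Finset.sum_comm]
  exact Finset.sum_congr rfl fun j _ => Finset.sum_congr rfl fun q _ => by ring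

lemma sum_meanSimilarity_eq (α : Fin M → ℕ × ℕ → ℝ) (σ : Fin N → ℤ) (c : Fin N → Fin N → ℝ) :
    ∑ i, ∑ j, c i j * meanSimilarity d α σ i j =
      ∑ q, (∑ i, ∑ j, c i j * incidence q i j) * prob d α σ q := by
  simp only [meanSimilarity, Finset.sum_mul, Finset.mul_sum]
  symm
  rw [Finset.sum_comm]
  refine Finset.sum_congr rfl fun i _ => ?_
  rw [Finset.sum_comm]
  exact Finset.sum_congr rfl fun j _ => Finset.sum_congr rfl fun q _ => by ring

lemma row_incidence_le (q : Slot N d) (i : Fin N) :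
    ∑ j, incidence q i j ≤ if i ∈ q.2.1 then (d q.1 : ℝ) else 0 := by
  have : ∀ j, incidence q i j ≤ if i ∈ q.2.1 then (if j ∈ q.2.1 then (1 : ℝ) else 0) else 0 := by
    intro j
    unfold incidence
    by_cases h : i ∈ q.2.1 <;> by_cases h' : j ∈ q.2.1 <;> by_cases h'' : i = j <;>
      simp [h, h', h'']
  refine (Finset.sum_le_sum fun j _ => this j).trans ?_
  split_ifs
  · simp [q.2.2]
  · simp

lemma sum_incidence_le (q : Slot N d) : ∑ i, ∑ j, incidence q i j ≤ (d q.1 : ℝ) ^ 2 := by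
  refine (Finset.sum_le_sum fun i _ => row_incidence_le q i).trans ?_
  rw [← Finset.sum_filter]
  simp [q.2.2, sq]

end Statistics

/-! ### Uniformly negligible events: degrees, cut norm, density of small sets -/

section Negligible

variable {M : ℕ} {d : Fin M → ℕ} {α : Fin M → ℕ × ℕ → ℝ}

/-- A family of events whose conditional probability tends to zero, uniformly in the balanced
community structure. -/
def Negligible (d : Fin M → ℕ) (α : Fin M → ℕ × ℕ → ℝ)
    (bad : ∀ n : ℕ, (Fin (2 * n) → ℤ) → Set (Hypergraph (2 * n) d)) : Prop :=
  ∀ ε > 0, ∀ᶠ n in atTop, ∀ σ ∈ balanced (2 * n), (condLaw (2 * n) d α σ).real (bad n σ) ≤ ε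

variable {bad bad' : ∀ n : ℕ, (Fin (2 * n) → ℤ) → Set (Hypergraph (2 * n) d)}

lemma Negligible.of_le (b : ℕ → ℝ) (hb : Tendsto b atTop (𝓝 0))
    (h : ∀ᶠ n in atTop, ∀ σ ∈ balanced (2 * n), (condLaw (2 * n) d α σ).real (bad n σ) ≤ b n) :
    Negligible d α bad := by
  intro ε hε
  filter_upwards [h, hb.eventually (eventually_le_nhds hε)] with n h1 h2 σ hσ
  exact (h1 σ hσ).trans h2

lemma Negligible.union (h : Negligible d α bad) (h' : Negligible d α bad') :
    Negligible d α (fun n σ => bad n σ ∪ bad' n σ) := by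
  intro ε hε
  filter_upwards [h (ε / 2) (by positivity), h' (ε / 2) (by positivity)] with n h1 h2 σ hσ
  refine (measureReal_union_le _ _).trans ?_
  linarith [h1 σ hσ, h2 σ hσ]

lemma Negligible.mono (h : Negligible d α bad)
    (hsub : ∀ᶠ n in atTop, ∀ σ ∈ balanced (2 * n), bad' n σ ⊆ bad n σ) : Negligible d α bad' := by
  intro ε hε
  filter_upwards [h ε hε, hsub] with n h1 h2 σ hσ
  exact (measureReal_mono (h2 σ hσ)).trans (h1 σ hσ)

/-- The union bound. -/
lemma measureReal_exists_le {Ω ι : Type*} [MeasurableSpace Ω] (μ : Measure Ω) [IsFiniteMeasure μ]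
    [Fintype ι] (P : ι → Ω → Prop) (b : ι → ℝ) (h : ∀ i, μ.real {ω | P i ω} ≤ b i) :
    μ.real {ω | ∃ i, P i ω} ≤ ∑ i, b i := by
  have : {ω | ∃ i, P i ω} = ⋃ i, {ω | P i ω} := by ext; simp
  rw [this]
  exact (measureReal_iUnion_fintype_le _).trans (Finset.sum_le_sum fun i _ => h i)

lemma tendsto_log_two_mul : Tendsto (fun n : ℕ => Real.log (2 * n : ℕ)) atTop atTop := by
  refine Real.tendsto_log_atTop.comp (tendsto_natCast_atTop_atTop.comp ?_)
  exact tendsto_id.const_mul_atTop' (by norm_num)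

lemma tendsto_inv_two_mul : Tendsto (fun n : ℕ => ((2 * n : ℕ) : ℝ)⁻¹) atTop (𝓝 0) := by
  refine tendsto_inv_atTop_zero.comp (tendsto_natCast_atTop_atTop.comp ?_)
  exact tendsto_id.const_mul_atTop' (by norm_num)

variable {a D : ℝ}

lemma exp_neg_two_mul_log {x : ℝ} (hx : 0 < x) : Real.exp (-2 * Real.log x) = x⁻¹ ^ 2 := by
  rw [show -2 * Real.log x = -Real.log x + -Real.log x by ring, Real.exp_add, Real.exp_neg,
    Real.exp_log hx, sq]

/-- With high probability all row sums of the similarity matrix are of order `log N`. -/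
lemma Bounds.negligible_degree (h : Bounds d α a D) :
    Negligible d α fun n _ => {A | ∃ i, (Real.exp D * (M * a) + 2) * Real.log (2 * n : ℕ) ≤
      ∑ j, similarity A i j} := by
  refine Negligible.of_le _ tendsto_inv_two_mul ?_
  filter_upwards [eventually_ge_atTop 1] with n hn σ hσ
  set ℓ := Real.log (2 * n : ℕ) with hℓ
  have hN : (0 : ℝ) < (2 * n : ℕ) := by exact_mod_cast (by omega : 0 < 2 * n)
  have hp := h.prob_nonneg hσ.1
  -- The threshold is the bound for the log moment generating function plus `2 log N`, which leaves
  -- `N⁻²` for each of the `N` rows.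
  have key : ∀ i : Fin (2 * n), (condLaw (2 * n) d α σ).real
      {A | (Real.exp D * (M * a) + 2) * ℓ ≤ ∑ j, similarity A i j} ≤
      (((2 * n : ℕ) : ℝ)⁻¹) ^ 2 := by
    intro i
    have h1 := condLaw_chernoff hp (fun q => ∑ j, incidence q i j)
      ((Real.exp D * (M * a) + 2) * ℓ)
    have h2 : ∀ A : Hypergraph (2 * n) d, ∑ q, (∑ j, incidence q i j) * indic (A q) =
        ∑ j, similarity A i j := by
      intro A
      simp only [similarity_apply, Finset.sum_mul]
      exact Finset.sum_comm
    simp only [h2] at h1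
    refine h1.trans ?_
    have h3 : ∑ q : Slot (2 * n) d, prob d α σ q * (Real.exp (∑ j, incidence q i j) - 1) ≤
        Real.exp D * (M * (a * ℓ)) := by
      refine le_trans ?_ (mul_le_mul_of_nonneg_left (h.sum_prob_node_le hσ.1 i)
        (Real.exp_pos D).le)
      rw [Finset.mul_sum]
      refine Finset.sum_le_sum fun q _ => ?_
      have h4 := row_incidence_le q i
      have h4' : 0 ≤ ∑ j, incidence q i j := Finset.sum_nonneg fun j _ => incidence_nonneg q i j
      split_ifs at h4 ⊢ with hi
      · have h5 : Real.exp (∑ j, incidence q i j) ≤ Real.exp D :=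
          Real.exp_le_exp.mpr (h4.trans (h.d_le q.1))
        have := hp q
        nlinarith
      · rw [le_antisymm h4 h4']; simp
    have h6 : (((2 * n : ℕ) : ℝ)⁻¹) ^ 2 = Real.exp (-2 * ℓ) := (exp_neg_two_mul_log hN).symm
    rw [h6]
    apply Real.exp_le_exp.mpr
    linarith
  refine (measureReal_exists_le _ _ _ key).trans (le_of_eq ?_)
  simp only [Finset.sum_const, Finset.card_univ, Fintype.card_fin, nsmul_eq_mul]
  field_simp

lemma abs_signOf (b : Bool) : |signOf b| = 1 := by
  cases b <;> simp [signOf]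

/-- Slots are nonempty, so each is counted at least once in the sum over nodes. -/
lemma Bounds.sum_prob_le {N : ℕ} {σ : Fin N → ℤ} (h : Bounds d α a D)
    (hσ : ∀ i, σ i = 1 ∨ σ i = -1) :
    ∑ q : Slot N d, prob d α σ q ≤ N * (M * (a * Real.log N)) := by
  have hp := h.prob_nonneg hσ
  calc ∑ q : Slot N d, prob d α σ q
      ≤ ∑ q : Slot N d, ∑ i, (if i ∈ q.2.1 then prob d α σ q else 0) := by
        refine Finset.sum_le_sum fun q _ => ?_
        have hne : q.2.1.Nonempty := by
          rw [← Finset.card_pos, q.2.2]; linarith [h.two_le q.1]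
        obtain ⟨i, hi⟩ := hne
        have := Finset.single_le_sum (f := fun i => if i ∈ q.2.1 then prob d α σ q else 0)
          (fun i _ => by
            have := hp q
            split_ifs <;> simp [this]) (Finset.mem_univ i)
        simpa [hi] using this
    _ = ∑ i, ∑ q : Slot N d, (if i ∈ q.2.1 then prob d α σ q else 0) := Finset.sum_comm
    _ ≤ ∑ _i : Fin N, M * (a * Real.log N) :=
        Finset.sum_le_sum fun i _ => h.sum_prob_node_le hσ i
    _ = _ := by simp

/-- With high probability the cut norm of the centred similarity matrix is `o(N log N)`. -/
lemma Bounds.negligible_cut (h : Bounds d α a D) {κ : ℝ} (hκ : 0 < κ) :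
    Negligible d α fun n σ => {A | ∃ st : (Fin (2 * n) → Bool) × (Fin (2 * n) → Bool),
      κ * Real.log (2 * n : ℕ) * (2 * n : ℕ) ≤
        ∑ i, ∑ j, signOf (st.1 i) * signOf (st.2 j) *
          (similarity A i j - meanSimilarity d α σ i j)} := by
  have ha := h.a_pos
  have hD := h.one_le
  -- The Chernoff parameter: the first condition puts the exponents in `[-1, 1]`, where `exp u - 1 -
  -- u ≤ u ^ 2`; the second lets this quadratic error consume at most half of the linear gain.
  obtain ⟨c, hc0, hc1, hc2⟩ : ∃ c : ℝ, 0 < c ∧ c * D ^ 2 ≤ 1 ∧ c * D ^ 4 * (M * a) ≤ κ / 2 := by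
    refine ⟨min (1 / D ^ 2) (κ / 2 / (D ^ 4 * (M * a + 1))), by positivity, ?_, ?_⟩
    · rw [← le_div_iff₀ (by positivity)]; exact min_le_left _ _
    · calc _ ≤ κ / 2 / (D ^ 4 * (M * a + 1)) * D ^ 4 * (M * a) := by
            gcongr; exact min_le_right _ _
        _ ≤ κ / 2 / (D ^ 4 * (M * a + 1)) * D ^ 4 * (M * a + 1) := by gcongr; linarith
        _ = κ / 2 := by field_simp
  refine Negligible.of_le (fun n : ℕ => Real.exp (-(2 * n : ℕ))) ?_ ?_
  · refine Real.tendsto_exp_neg_atTop_nhds_zero.comp (tendsto_natCast_atTop_atTop.comp ?_)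
    exact tendsto_id.const_mul_atTop' (by norm_num)
  -- From here on the remaining gain `c * κ * log N * N / 2` is at least `3 N`, against `4 ^ N ≤ exp
  -- (2 N)` pairs of sign vectors.
  filter_upwards [tendsto_log_two_mul.eventually_ge_atTop (6 / (c * κ))] with n hn σ hσ
  set ℓ := Real.log (2 * n : ℕ) with hℓ
  set N : ℝ := ((2 * n : ℕ) : ℝ) with hN
  have hN0 : 0 ≤ N := by positivity
  have hℓ0 : 0 ≤ ℓ := Real.log_natCast_nonneg _
  have hp := h.prob_nonneg hσ.1
  have key : ∀ st : (Fin (2 * n) → Bool) × (Fin (2 * n) → Bool),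
      (condLaw (2 * n) d α σ).real {A | κ * ℓ * N ≤
        ∑ i, ∑ j, signOf (st.1 i) * signOf (st.2 j) *
          (similarity A i j - meanSimilarity d α σ i j)} ≤ Real.exp (-(3 * N)) := by
    rintro ⟨s, t⟩
    set F : Slot (2 * n) d → ℝ := fun q =>
      ∑ i, ∑ j, signOf (s i) * signOf (t j) * incidence q i j with hF
    have hFb : ∀ q, |F q| ≤ D ^ 2 := by
      intro q
      have hdq := h.d_le q.1
      calc |F q| ≤ ∑ i, ∑ j, |signOf (s i) * signOf (t j) * incidence q i j| :=
            (Finset.abs_sum_le_sum_abs _ _).trans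
              (Finset.sum_le_sum fun i _ => Finset.abs_sum_le_sum_abs _ _)
        _ = ∑ i, ∑ j, incidence q i j := by
            refine Finset.sum_congr rfl fun i _ => Finset.sum_congr rfl fun j _ => ?_
            rw [abs_mul, abs_mul, abs_signOf, abs_signOf, abs_of_nonneg (incidence_nonneg q i j)]
            ring
        _ ≤ (d q.1 : ℝ) ^ 2 := sum_incidence_le q
        _ ≤ D ^ 2 := by gcongr
    have h1 := condLaw_chernoff hp (fun q => c * F q)
      (c * (κ * ℓ * N) + ∑ q, c * F q * prob d α σ q)
    have hset : {A : Hypergraph (2 * n) d | κ * ℓ * N ≤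
        ∑ i, ∑ j, signOf (s i) * signOf (t j) *
          (similarity A i j - meanSimilarity d α σ i j)} =
        {A | c * (κ * ℓ * N) + ∑ q, c * F q * prob d α σ q ≤ ∑ q, c * F q * indic (A q)} := by
      ext A
      simp only [Set.mem_ofPred_eq, mul_sub, Finset.sum_sub_distrib]
      rw [sum_similarity_eq, sum_meanSimilarity_eq]
      simp only [mul_assoc c]
      rw [← Finset.mul_sum, ← Finset.mul_sum, ← mul_add, mul_le_mul_iff_right₀ hc0,
        le_sub_iff_add_le]
    rw [hset]
    refine h1.trans (Real.exp_le_exp.mpr ?_)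
    have h2 : ∑ q, prob d α σ q * (Real.exp (c * F q) - 1) - ∑ q, c * F q * prob d α σ q ≤
        c * (κ * ℓ * N) / 2 := by
      rw [← Finset.sum_sub_distrib]
      calc _ ≤ ∑ q, c ^ 2 * D ^ 4 * prob d α σ q := by
            refine Finset.sum_le_sum fun q _ => ?_
            have hx : |c * F q| ≤ c * D ^ 2 := by
              rw [abs_mul, abs_of_pos hc0]
              exact mul_le_mul_of_nonneg_left (hFb q) hc0.le
            have h3 := (abs_le.mp (Real.abs_exp_sub_one_sub_id_le (hx.trans hc1))).2
            have h4 : (c * F q) ^ 2 ≤ (c * D ^ 2) ^ 2 := sq_le_sq' (abs_le.mp hx).1 (abs_le.mp hx).2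
            have h5 : prob d α σ q * (Real.exp (c * F q) - 1 - c * F q) ≤
                prob d α σ q * (c * D ^ 2) ^ 2 :=
              mul_le_mul_of_nonneg_left (h3.trans h4) (hp q)
            nlinarith
        _ = c * (c * D ^ 4) * ∑ q : Slot (2 * n) d, prob d α σ q := by
            rw [← Finset.mul_sum]; ring
        _ ≤ c * (c * D ^ 4) * (N * (M * (a * ℓ))) := by
            gcongr
            exact h.sum_prob_le hσ.1
        _ = c * (c * D ^ 4 * (M * a)) * (ℓ * N) := by ring
        _ ≤ c * (κ / 2) * (ℓ * N) := by gcongr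
        _ = _ := by ring
    have h6 : 6 ≤ ℓ * (c * κ) := by
      rwa [div_le_iff₀ (by positivity)] at hn
    nlinarith
  refine (measureReal_exists_le _ _ _ key).trans ?_
  simp only [Finset.sum_const, Finset.card_univ, Fintype.card_prod, Fintype.card_pi,
    Fintype.card_bool, Finset.prod_const, Fintype.card_fin, nsmul_eq_mul]
  have h7 : ((2 : ℝ) ^ (2 * n)) ≤ Real.exp N := by
    rw [hN, ← Real.exp_one_pow]
    have := Real.add_one_le_exp 1
    gcongr
    linarith
  push_cast
  calc (2 : ℝ) ^ (2 * n) * 2 ^ (2 * n) * Real.exp (-(3 * N))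
      ≤ Real.exp N * Real.exp N * Real.exp (-(3 * N)) := by gcongr
    _ = Real.exp (-N) := by rw [← Real.exp_add, ← Real.exp_add]; congr 1; ring
    _ = _ := by rw [hN]

/-- The binomial theorem over subsets. With `x = N⁻²` it sums the failure probabilities of all
nonempty node sets to at most `exp (1 / N) - 1`. -/
lemma sum_nonempty_pow_card (N : ℕ) (x : ℝ) :
    ∑ U : Finset (Fin N), (if U.Nonempty then x ^ U.card else 0) = (x + 1) ^ N - 1 := by
  have h := Finset.sum_pow_mul_eq_add_pow x 1 (Finset.univ : Finset (Fin N))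
  simp only [one_pow, mul_one, Finset.powerset_univ, Finset.card_univ, Fintype.card_fin] at h
  rw [← h, eq_sub_iff_add_eq]
  have h1 : (1 : ℝ) = ∑ U : Finset (Fin N), if U = ∅ then 1 else 0 := by simp
  conv_lhs => rw [h1]
  rw [← Finset.sum_add_distrib]
  refine Finset.sum_congr rfl fun U _ => ?_
  rcases U.eq_empty_or_nonempty with rfl | hU
  · simp
  · simp [hU, hU.ne_empty]

/-- With high probability the similarity matrix has density `o(log N)` on all sets that contain
at most a small fraction of the nodes. -/
lemma Bounds.negligible_density (h : Bounds d α a D) {κ : ℝ} (hκ : 0 < κ) :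
    ∃ δ > 0, Negligible d α fun n _ => {A | ∃ U : Finset (Fin (2 * n)),
      (U.card : ℝ) ≤ δ * (2 * n : ℕ) ∧
        κ * Real.log (2 * n : ℕ) * U.card < ∑ i ∈ U, ∑ j ∈ U, similarity A i j} := by
  have ha := h.a_pos
  have hD := h.one_le
  -- With this parameter the threshold contributes `3 |U| log N` to the exponent. The mean
  -- contributes at most `(B |U| / N) |U| log N`, hence at most `|U| log N` when `|U| ≤ N / (B +
  -- 1)`. What is left is `N⁻²` to the power `|U|`.
  set c := 3 / κ with hc
  have hc0 : 0 < c := by positivity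
  set B := c * Real.exp (c * D ^ 2) * (2 * M * a * D) with hB
  have hB0 : 0 ≤ B := by positivity
  refine ⟨1 / (B + 1), by positivity, ?_⟩
  refine Negligible.of_le (fun n : ℕ => Real.exp (((2 * n : ℕ) : ℝ)⁻¹) - 1) ?_ ?_
  · have := (Real.continuous_exp.tendsto 0).comp tendsto_inv_two_mul
    have := this.sub_const 1
    simpa using this
  filter_upwards [eventually_ge_atTop 1] with n hn σ hσ
  set ℓ := Real.log (2 * n : ℕ) with hℓ
  have hℓ0 : 0 ≤ ℓ := Real.log_natCast_nonneg _
  have hN : (0 : ℝ) < (2 * n : ℕ) := by exact_mod_cast (by omega : 0 < 2 * n)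
  have hp := h.prob_nonneg hσ.1
  have hexp : Real.exp (-2 * ℓ) = (((2 * n : ℕ) : ℝ)⁻¹) ^ 2 :=
    exp_neg_two_mul_log hN
  have key : ∀ U : Finset (Fin (2 * n)), (condLaw (2 * n) d α σ).real
      {A | (U.card : ℝ) ≤ 1 / (B + 1) * (2 * n : ℕ) ∧
        κ * ℓ * U.card < ∑ i ∈ U, ∑ j ∈ U, similarity A i j} ≤
      if U.Nonempty then ((((2 * n : ℕ) : ℝ)⁻¹) ^ 2) ^ U.card else 0 := by
    intro U
    -- The inequality in the event is strict, so the empty set never violates the density bound.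
    rcases U.eq_empty_or_nonempty with rfl | hU
    · simp
    rw [if_pos hU]
    by_cases hUc : (U.card : ℝ) ≤ 1 / (B + 1) * (2 * n : ℕ)
    swap
    · simp only [hUc, false_and, Set.ofPred_false, measureReal_empty]
      positivity
    set u : ℝ := (U.card : ℝ) with hu
    have hu0 : 0 ≤ u := by positivity
    set G : Slot (2 * n) d → ℝ := fun q => ∑ i ∈ U, ∑ j ∈ U, incidence q i j with hG
    have hG0 : ∀ q, 0 ≤ G q := fun q =>
      Finset.sum_nonneg fun i _ => Finset.sum_nonneg fun j _ => incidence_nonneg q i j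
    have hGD : ∀ q, G q ≤ D ^ 2 := by
      intro q
      have hdq := h.d_le q.1
      calc G q ≤ ∑ i ∈ U, ∑ j, incidence q i j := Finset.sum_le_sum fun i _ =>
            Finset.sum_le_sum_of_subset_of_nonneg (Finset.subset_univ U)
              fun j _ _ => incidence_nonneg q i j
        _ ≤ ∑ i, ∑ j, incidence q i j :=
            Finset.sum_le_sum_of_subset_of_nonneg (Finset.subset_univ U)
              fun i _ _ => Finset.sum_nonneg fun j _ => incidence_nonneg q i j
        _ ≤ (d q.1 : ℝ) ^ 2 := sum_incidence_le q
        _ ≤ D ^ 2 := by gcongr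
    have hswap : ∀ f : Slot (2 * n) d → ℝ, ∑ q, G q * f q =
        ∑ i ∈ U, ∑ j ∈ U, ∑ q, incidence q i j * f q := by
      intro f
      simp only [hG, Finset.sum_mul]
      rw [Finset.sum_comm]
      exact Finset.sum_congr rfl fun i _ => Finset.sum_comm
    have h1 := condLaw_chernoff hp (fun q => c * G q) (c * (κ * ℓ * u))
    have hset : {A : Hypergraph (2 * n) d | u ≤ 1 / (B + 1) * (2 * n : ℕ) ∧
        κ * ℓ * u < ∑ i ∈ U, ∑ j ∈ U, similarity A i j} ⊆
        {A | c * (κ * ℓ * u) ≤ ∑ q, c * G q * indic (A q)} := by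
      rintro A ⟨_, hA⟩
      simp only [similarity_apply] at hA
      rw [← hswap] at hA
      simp only [Set.mem_ofPred_eq, mul_assoc c]
      rw [← Finset.mul_sum]
      exact mul_le_mul_of_nonneg_left hA.le hc0.le
    refine (measureReal_mono hset).trans (h1.trans ?_)
    rw [← hexp, ← Real.exp_nat_mul]
    apply Real.exp_le_exp.mpr
    have h2 : ∑ q, prob d α σ q * (Real.exp (c * G q) - 1) ≤
        c * Real.exp (c * D ^ 2) * ∑ q, G q * prob d α σ q := by
      rw [Finset.mul_sum]
      refine Finset.sum_le_sum fun q _ => ?_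
      have h3 : Real.exp (c * G q) - 1 ≤ c * G q * Real.exp (c * G q) := by
        have h4 := Real.add_one_le_exp (-(c * G q))
        have h5 := mul_le_mul_of_nonneg_right h4 (Real.exp_pos (c * G q)).le
        rw [← Real.exp_add, neg_add_cancel, Real.exp_zero] at h5
        linarith
      have h4 : Real.exp (c * G q) ≤ Real.exp (c * D ^ 2) :=
        Real.exp_le_exp.mpr (mul_le_mul_of_nonneg_left (hGD q) hc0.le)
      have h5 : c * G q * Real.exp (c * G q) ≤ c * G q * Real.exp (c * D ^ 2) :=
        mul_le_mul_of_nonneg_left h4 (mul_nonneg hc0.le (hG0 q))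
      calc _ ≤ prob d α σ q * (c * G q * Real.exp (c * D ^ 2)) :=
            mul_le_mul_of_nonneg_left (h3.trans h5) (hp q)
        _ = _ := by ring
    have h6 : ∑ q, G q * prob d α σ q ≤ u * (u * (2 * M * a * D * ℓ / (2 * n : ℕ))) := by
      rw [hswap]
      calc _ ≤ ∑ i ∈ U, ∑ j ∈ U, 2 * M * a * D * ℓ / (2 * n : ℕ) :=
            Finset.sum_le_sum fun i _ => Finset.sum_le_sum fun j _ =>
              h.meanSimilarity_le hσ.1 (by omega) i j
        _ = _ := by simp [hu]
    have h7 : c * Real.exp (c * D ^ 2) * (u * (u * (2 * M * a * D * ℓ / (2 * n : ℕ)))) ≤ u * ℓ := by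
      have e : c * Real.exp (c * D ^ 2) * (u * (u * (2 * M * a * D * ℓ / (2 * n : ℕ)))) =
        (B * u / (2 * n : ℕ)) * (u * ℓ) := by rw [hB]; ring
      rw [e]
      have : B * u / (2 * n : ℕ) ≤ 1 := by
        rw [div_le_one hN]
        calc B * u ≤ B * (1 / (B + 1) * (2 * n : ℕ)) := by gcongr
          _ = B / (B + 1) * (2 * n : ℕ) := by ring
          _ ≤ 1 * (2 * n : ℕ) := by
            gcongr
            rw [div_le_one (by positivity)]; linarith
          _ = _ := one_mul _
      exact mul_le_of_le_one_left (by positivity) this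
    have h8 : c * (κ * ℓ * u) = 3 * (u * ℓ) := by rw [hc]; field_simp
    have h9 : c * Real.exp (c * D ^ 2) * ∑ q, G q * prob d α σ q ≤ u * ℓ :=
      (mul_le_mul_of_nonneg_left h6 (by positivity)).trans h7
    rw [h8]
    linarith
  refine (measureReal_exists_le _ _ _ key).trans ?_
  rw [sum_nonempty_pow_card]
  have h1 : ((((2 * n : ℕ) : ℝ)⁻¹) ^ 2 + 1) ^ (2 * n) ≤ Real.exp (((2 * n : ℕ) : ℝ)⁻¹) := by
    calc _ ≤ (Real.exp ((((2 * n : ℕ) : ℝ)⁻¹) ^ 2)) ^ (2 * n) := by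
          gcongr
          exact Real.add_one_le_exp _
      _ = _ := by
          rw [← Real.exp_nat_mul]; congr 1; field_simp
  linarith

end Negligible


/-! ### Binomial limits of the hypergeometric weights -/

/-- Growth of a binomial coefficient with fixed lower index along a sequence of linear growth. -/
lemma tendsto_choose_div_pow {u : ℕ → ℕ} (hu : Tendsto u atTop atTop) {c : ℝ}
    (hc : Tendsto (fun n : ℕ => (u n : ℝ) / n) atTop (𝓝 c)) (k : ℕ) :
    Tendsto (fun n : ℕ => ((u n).choose k : ℝ) / (n : ℝ) ^ k) atTop (𝓝 (c ^ k / k.factorial)) := by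
  have h1 : Tendsto (fun n : ℕ => (n.choose k : ℝ) / ((n : ℝ) ^ k / k.factorial)) atTop (𝓝 1) := by
    refine (Asymptotics.isEquivalent_iff_tendsto_one ?_).mp (isEquivalent_choose k)
    filter_upwards [eventually_ge_atTop 1] with n hn
    have : (0 : ℝ) < n := by exact_mod_cast hn
    positivity
  have h2 := ((h1.comp hu).mul (hc.pow k)).div_const (k.factorial : ℝ)
  rw [one_mul] at h2
  refine h2.congr' ?_
  filter_upwards [eventually_ge_atTop 1, hu.eventually_ge_atTop 1] with n hn hun
  have h3 : (0 : ℝ) < n := by exact_mod_cast hn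
  have h4 : (0 : ℝ) < u n := by exact_mod_cast hun
  simp only [Function.comp_apply, div_pow]
  field_simp

/-- Hypergeometric weights converge to binomial weights. -/
lemma tendsto_hypergeometric {k r : ℕ} (hr : r ≤ k) :
    Tendsto (fun n : ℕ => (n.choose r : ℝ) * ((n - 1).choose (k - r)) / ((2 * n - 1).choose k))
      atTop (𝓝 (((2 : ℝ) ^ k)⁻¹ * (k.choose r))) := by
  have hn1 : Tendsto (fun n : ℕ => n - 1) atTop atTop := tendsto_sub_atTop_nat 1
  have hn2 : Tendsto (fun n : ℕ => 2 * n - 1) atTop atTop :=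
    (tendsto_sub_atTop_nat 1).comp (tendsto_id.const_mul_atTop' (by norm_num))
  have hinv : Tendsto (fun n : ℕ => ((n : ℝ))⁻¹) atTop (𝓝 0) :=
    tendsto_inv_atTop_zero.comp tendsto_natCast_atTop_atTop
  have c0 : Tendsto (fun n : ℕ => ((n : ℕ) : ℝ) / n) atTop (𝓝 1) := by
    refine tendsto_const_nhds.congr' ?_
    filter_upwards [eventually_ge_atTop 1] with n hn
    have h3 : (0 : ℝ) < n := by exact_mod_cast hn
    field_simp
  have c1 : Tendsto (fun n : ℕ => ((n - 1 : ℕ) : ℝ) / n) atTop (𝓝 1) := by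
    have := hinv.const_sub 1
    rw [sub_zero] at this
    refine this.congr' ?_
    filter_upwards [eventually_ge_atTop 1] with n hn
    have h3 : (0 : ℝ) < n := by exact_mod_cast hn
    rw [Nat.cast_sub hn]
    field_simp
    simp
  have c2 : Tendsto (fun n : ℕ => ((2 * n - 1 : ℕ) : ℝ) / n) atTop (𝓝 2) := by
    have := hinv.const_sub 2
    rw [sub_zero] at this
    refine this.congr' ?_
    filter_upwards [eventually_ge_atTop 1] with n hn
    have h3 : (0 : ℝ) < n := by exact_mod_cast hn
    rw [Nat.cast_sub (by omega)]
    field_simp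
    simp
  have l0 := tendsto_choose_div_pow tendsto_id c0 r
  have l1 := tendsto_choose_div_pow hn1 c1 (k - r)
  have l2 := tendsto_choose_div_pow hn2 c2 k
  have l3 := (l0.mul l1).div l2 (by positivity)
  have hlim : 1 ^ r / (r.factorial : ℝ) * (1 ^ (k - r) / ((k - r).factorial : ℝ)) /
      (2 ^ k / (k.factorial : ℝ)) = ((2 : ℝ) ^ k)⁻¹ * (k.choose r) := by
    rw [Nat.cast_choose ℝ hr, one_pow, one_pow]
    field_simp
  rw [hlim] at l3
  refine l3.congr' ?_
  filter_upwards [eventually_ge_atTop 1] with n hn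
  have h3 : (0 : ℝ) < n := by exact_mod_cast hn
  have h4 : (n : ℝ) ^ k = (n : ℝ) ^ r * (n : ℝ) ^ (k - r) := by
    rw [← pow_add, Nat.add_sub_cancel' hr]
  simp only [Pi.div_apply, id]
  rw [h4, div_mul_div_comm, div_div_div_cancel_right₀ (by positivity)]

/-! ### Margins of the nodes -/

section Margin

variable {M : ℕ} {d : Fin M → ℕ} {α : Fin M → ℕ × ℕ → ℝ} {a D : ℝ}

/-- The tangent line bound `ψ(x) ≤ ξ x`. -/
lemma psi_le_assortativity_mul (hα : ∀ m, ∀ r ≤ d m, 0 < α m (r, d m - r)) (x : ℝ) :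
    psi d α x ≤ assortativity d α * x := by
  unfold psi assortativity
  rw [Finset.sum_mul]
  refine Finset.sum_le_sum fun m _ => ?_
  rw [Finset.mul_sum, Finset.sum_mul]
  refine Finset.sum_le_sum fun r hr => ?_
  have h1 := hα m r (Finset.mem_range.mp hr).le
  have h2 := Real.add_one_le_exp (-x * ((d m : ℝ) - 1 - 2 * r))
  calc _ ≤ ((2 : ℝ) ^ (d m - 1))⁻¹ * ((d m - 1).choose r : ℝ) * α m (r, d m - r) *
        (x * ((d m : ℝ) - 1 - 2 * r)) := by
        gcongr
        linarith
    _ = _ := by ring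

/-- The finite-size version of `ψ`. -/
noncomputable def finitePsi (n : ℕ) (d : Fin M → ℕ) (α : Fin M → ℕ × ℕ → ℝ) (x : ℝ) : ℝ :=
  ∑ m, ∑ r ∈ Finset.range (d m),
    (n.choose r : ℝ) * ((n - 1).choose (d m - 1 - r)) / ((2 * n - 1).choose (d m - 1)) *
      α m (r, d m - r) * (1 - Real.exp (-x * ((d m : ℝ) - 1 - 2 * r)))

lemma tendsto_finitePsi (x : ℝ) :
    Tendsto (fun n => finitePsi n d α x) atTop (𝓝 (psi d α x)) := by
  unfold finitePsi psi
  refine tendsto_finsetSum _ fun m _ => tendsto_finsetSum _ fun r hr => ?_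
  have hr' : r ≤ d m - 1 := by have := Finset.mem_range.mp hr; omega
  exact ((tendsto_hypergeometric hr').mul_const _).mul_const _

lemma tendsto_log_div_two_mul :
    Tendsto (fun n : ℕ => Real.log (2 * n : ℕ) / (2 * n : ℕ)) atTop (𝓝 0) := by
  have h := Real.isLittleO_log_id_atTop.tendsto_div_nhds_zero
  refine h.comp (tendsto_natCast_atTop_atTop.comp ?_)
  exact tendsto_id.const_mul_atTop' (by norm_num)

/-- From `k * m.choose k = m * (m - 1).choose (k - 1)`, whose last factor is at least `1`. This
linear growth outweighs `log N` in the hyperedge probabilities. -/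
lemma div_le_choose {m k : ℕ} (hk : 1 ≤ k) (hkm : k ≤ m) : (m : ℝ) / k ≤ m.choose k := by
  obtain ⟨k, rfl⟩ : ∃ j, k = j + 1 := ⟨k - 1, by omega⟩
  obtain ⟨m, rfl⟩ : ∃ j, m = j + 1 := ⟨m - 1, by omega⟩
  have h := Nat.add_one_mul_choose_eq m k
  have h1 : 1 ≤ m.choose k := Nat.choose_pos (by omega)
  rw [div_le_iff₀ (by positivity)]
  have : m + 1 ≤ (m + 1).choose (k + 1) * (k + 1) := by rw [← h]; nlinarith
  exact_mod_cast this

/-- For large `N` the truncation at `1` in the hyperedge probabilities is not active. -/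
lemma Bounds.eventually_edgeProb_eq (h : Bounds d α a D) :
    ∀ᶠ n : ℕ in atTop, ∀ m, ∀ r ≤ d m, edgeProb (2 * n) (d m) (α m (r, d m - r)) =
      α m (r, d m - r) * Real.log (2 * n : ℕ) / ((2 * n - 1).choose (d m - 1) : ℝ) := by
  have ha := h.a_pos
  have hD := h.one_le
  have h0 : (0 : ℝ) < 1 / (2 * D * a) := by positivity
  filter_upwards [tendsto_log_div_two_mul.eventually (eventually_le_nhds h0),
    eventually_ge_atTop (1 + ⌈D⌉₊)] with n hn hnD m r hr
  unfold edgeProb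
  apply min_eq_left
  have hdm := h.two_le m
  have hdn : d m ≤ n := by
    have h1 : (d m : ℝ) ≤ (⌈D⌉₊ : ℝ) := (h.d_le m).trans (Nat.le_ceil D)
    have h2 : d m ≤ ⌈D⌉₊ := by exact_mod_cast h1
    omega
  have hN : (0 : ℝ) < (2 * n : ℕ) := by exact_mod_cast (by omega : 0 < 2 * n)
  have hℓ := Real.log_natCast_nonneg (2 * n)
  have hc := div_le_choose (m := 2 * n - 1) (k := d m - 1) (by omega) (by omega)
  have hc' : ((2 * n : ℕ) : ℝ) / (2 * D) ≤ ((2 * n - 1).choose (d m - 1) : ℝ) := by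
    refine le_trans ?_ hc
    have h1 : (0 : ℝ) < ((d m - 1 : ℕ) : ℝ) := by exact_mod_cast (by omega : 0 < d m - 1)
    rw [div_le_div_iff₀ (by positivity) h1]
    have h2 : ((d m - 1 : ℕ) : ℝ) ≤ D := by
      refine le_trans ?_ (h.d_le m)
      exact_mod_cast Nat.sub_le _ _
    have h3 : ((2 * n : ℕ) : ℝ) ≤ 2 * ((2 * n - 1 : ℕ) : ℝ) := by
      exact_mod_cast (by omega : 2 * n ≤ 2 * (2 * n - 1))
    nlinarith
  have hpos : (0 : ℝ) < ((2 * n - 1).choose (d m - 1) : ℝ) := lt_of_lt_of_le (by positivity) hc'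
  rw [div_le_one hpos]
  refine le_trans ?_ hc'
  rw [div_le_iff₀ hN, div_mul_eq_mul_div, one_mul, le_div_iff₀ (by positivity)] at hn
  rw [le_div_iff₀ (by positivity)]
  have h4 := h.le m r hr
  have h5 : α m (r, d m - r) * Real.log (2 * n : ℕ) ≤ a * Real.log (2 * n : ℕ) := by gcongr
  nlinarith

lemma sum_signs {N : ℕ} {σ : Fin N → ℤ} (hσ : ∀ i, σ i = 1 ∨ σ i = -1) (e : Finset (Fin N)) :
    ∑ j ∈ e, (σ j : ℝ) = (profile σ e).2 - (profile σ e).1 := by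
  have h1 : ∀ i, (σ i : ℝ) = (if σ i = 1 then 1 else 0) - (if σ i = -1 then 1 else 0) := by
    intro i
    rcases hσ i with h | h <;> simp [h]
  simp only [h1, Finset.sum_sub_distrib, Finset.sum_boole, profile]

/-- The contribution of a hyperedge to the margin of a node. -/
lemma sum_incidence_signs {N : ℕ} {σ : Fin N → ℤ} (hσ : ∀ i, σ i = 1 ∨ σ i = -1) (q : Slot N d)
    (i : Fin N) : ∑ j, incidence q i j * ((σ i : ℝ) * σ j) =
      if i ∈ q.2.1 then σ i * ((profile σ q.2.1).2 - (profile σ q.2.1).1 : ℝ) - 1 else 0 := by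
  by_cases hi : i ∈ q.2.1
  · rw [if_pos hi, ← sum_signs hσ]
    -- The `-1` in the statement is the term `j = i`, present in the sum over the hyperedge but
    -- excluded from the similarity matrix.
    have h1 : ∀ j, incidence q i j * ((σ i : ℝ) * σ j) =
        (if j ∈ q.2.1 then (σ i : ℝ) * σ j else 0) - (if j = i then (1 : ℝ) else 0) := by
      intro j
      by_cases hij : j = i
      · subst hij
        have : (σ j : ℝ) * σ j = 1 := by rcases hσ j with h | h <;> simp [h]
        simp [incidence_self, hi, this]
      · have : i ≠ j := fun h => hij h.symm
        simp [incidence, hi, hij, this]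
    simp only [h1, Finset.sum_sub_distrib, Finset.mul_sum]
    simp
  · rw [if_neg hi]
    exact Finset.sum_eq_zero fun j _ => by simp [incidence, hi]

/-- The logarithmic moment generating function of the margin of a node. -/
lemma sum_prob_margin {n : ℕ} {σ : Fin (2 * n) → ℤ} (hd : ∀ m, 2 ≤ d m) (hsymm : IsSymmetric d α)
    (hσ : σ ∈ balanced (2 * n))
    (hedge : ∀ m, ∀ r ≤ d m, edgeProb (2 * n) (d m) (α m (r, d m - r)) =
      α m (r, d m - r) * Real.log (2 * n : ℕ) / ((2 * n - 1).choose (d m - 1) : ℝ))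
    (x : ℝ) (i : Fin (2 * n)) :
    ∑ q : Slot (2 * n) d, prob d α σ q *
      (Real.exp (-x * ∑ j, incidence q i j * ((σ i : ℝ) * σ j)) - 1) =
    -(Real.log (2 * n : ℕ) * finitePsi n d α x) := by
  rw [Fintype.sum_sigma, finitePsi, Finset.mul_sum, ← Finset.sum_neg_distrib]
  refine Finset.sum_congr rfl fun m _ => ?_
  have hdm := hd m
  have key := sum_node_profile hσ (d := d m) (by omega) i
    (fun y => edgeProb (2 * n) (d m) (α m y) * (Real.exp (-x * ((y.2 : ℝ) - y.1 - 1)) - 1))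
  have hL : ∑ e : {e : Finset (Fin (2 * n)) // e.card = d m}, prob d α σ ⟨m, e⟩ *
      (Real.exp (-x * ∑ j, incidence (d := d) ⟨m, e⟩ i j * ((σ i : ℝ) * σ j)) - 1) =
      ∑ e : {e : Finset (Fin (2 * n)) // e.card = d m},
        (if i ∈ e.1 then (fun y : ℕ × ℕ => edgeProb (2 * n) (d m) (α m y) *
          (Real.exp (-x * ((y.2 : ℝ) - y.1 - 1)) - 1))
            (if σ i = 1 then profile σ e.1 else (profile σ e.1).swap) else 0) := by
    refine Finset.sum_congr rfl fun e _ => ?_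
    rw [sum_incidence_signs hσ.1]
    by_cases hi : i ∈ e.1
    · simp only [hi, if_true]
      rcases hσ.1 i with h1 | h1
      · simp [h1, prob]
      · have h2 : ¬ ((-1 : ℤ) = 1) := by norm_num
        simp only [h1, h2, if_false, Prod.fst_swap, Prod.snd_swap, prob]
        -- Here the symmetry of `α` enters: a node of sign `-1` sees the swapped profile, which has
        -- the same probability.
        obtain ⟨r, hr, hq⟩ := profile_eq (d := d) hσ.1 ⟨m, e⟩
        simp only at hr hq
        rw [hq, Prod.swap_prod_mk, ← hsymm m r hr]
        congr 4
        push_cast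
        ring
    · simp [hi]
  rw [hL, key, Finset.mul_sum, ← Finset.sum_neg_distrib]
  refine Finset.sum_congr rfl fun r hr => ?_
  have hr' := (Finset.mem_range.mp hr).le
  simp only
  rw [hedge m r hr', Nat.cast_sub hr']
  have : (d m : ℝ) - r - r - 1 = d m - 1 - 2 * r := by ring
  rw [this]
  ring

/-- With high probability all nodes have a margin of order `log N`. -/
lemma Bounds.negligible_margin (h : Bounds d α a D) (hsymm : IsSymmetric d α) {s x : ℝ}
    (hs : s ^ 2 = 1) (hsx : 0 < s * x) (hx : 1 < psi d α x) :
    ∃ c > 0, Negligible d α fun n σ => {A | ∃ i, ∑ j, s * similarity A i j * ((σ i : ℝ) * σ j) ≤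
      c * Real.log (2 * n : ℕ)} := by
  set ε := psi d α x - 1 with hε
  have hε0 : 0 < ε := by linarith
  -- In units of `log N`, the Chernoff exponent at parameter `x` is then at most `ε / 4 - (1 + 3 * ε
  -- / 4) = -1 - ε / 2`: the `1` pays for the union over nodes, and `ε / 2` gives the decay.
  refine ⟨ε / (4 * (s * x)), by positivity, ?_⟩
  refine Negligible.of_le (fun n : ℕ => Real.exp (-(ε / 2 * Real.log (2 * n : ℕ)))) ?_ ?_
  · exact Real.tendsto_exp_neg_atTop_nhds_zero.comp
      (tendsto_log_two_mul.const_mul_atTop (by positivity))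
  filter_upwards [eventually_ge_atTop 1, h.eventually_edgeProb_eq,
    (tendsto_finitePsi (d := d) (α := α) x).eventually
      (lt_mem_nhds (show 1 + 3 * ε / 4 < psi d α x by linarith))] with n hn hedge hpsi σ hσ
  set ℓ := Real.log (2 * n : ℕ) with hℓ
  have hN : (0 : ℝ) < (2 * n : ℕ) := by exact_mod_cast (by omega : 0 < 2 * n)
  have hℓ0 : 0 ≤ ℓ := Real.log_natCast_nonneg _
  have hp := h.prob_nonneg hσ.1
  have key : ∀ i : Fin (2 * n), (condLaw (2 * n) d α σ).real
      {A | ∑ j, s * similarity A i j * ((σ i : ℝ) * σ j) ≤ ε / (4 * (s * x)) * ℓ} ≤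
      Real.exp (-ℓ) * Real.exp (-(ε / 2 * ℓ)) := by
    intro i
    have h1 := condLaw_chernoff hp
      (fun q => -x * ∑ j, incidence q i j * ((σ i : ℝ) * σ j)) (-(ε / 4 * ℓ))
    rw [sum_prob_margin h.two_le hsymm hσ hedge] at h1
    have hset : {A : Hypergraph (2 * n) d |
        ∑ j, s * similarity A i j * ((σ i : ℝ) * σ j) ≤ ε / (4 * (s * x)) * ℓ} ⊆
        {A | -(ε / 4 * ℓ) ≤
          ∑ q, (-x * ∑ j, incidence q i j * ((σ i : ℝ) * σ j)) * indic (A q)} := by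
      intro A hA
      simp only [Set.mem_ofPred_eq] at hA ⊢
      have e1 : ∑ q, (-x * ∑ j, incidence q i j * ((σ i : ℝ) * σ j)) * indic (A q) =
          -(s * x) * ∑ j, s * similarity A i j * ((σ i : ℝ) * σ j) := by
        have e2 : ∑ j, s * similarity A i j * ((σ i : ℝ) * σ j) =
            s * ∑ q, (∑ j, incidence q i j * ((σ i : ℝ) * σ j)) * indic (A q) := by
          simp only [similarity_apply, Finset.mul_sum, Finset.sum_mul]
          rw [Finset.sum_comm]
          exact Finset.sum_congr rfl fun q _ => Finset.sum_congr rfl fun j _ => by ring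
        rw [e2]
        simp only [mul_assoc (-x)]
        rw [← Finset.mul_sum]
        linear_combination (x * ∑ q, (∑ j, incidence q i j * ((σ i : ℝ) * σ j)) * indic (A q)) * hs
      rw [e1, neg_mul, neg_le_neg_iff]
      calc s * x * ∑ j, s * similarity A i j * ((σ i : ℝ) * σ j)
          ≤ s * x * (ε / (4 * (s * x)) * ℓ) := by gcongr
        _ = ε / 4 * ℓ := by
          generalize s * x = y at hsx
          field_simp
    refine (measureReal_mono hset).trans (h1.trans ?_)
    rw [← Real.exp_add]
    apply Real.exp_le_exp.mpr
    nlinarith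
  refine (measureReal_exists_le _ _ _ key).trans (le_of_eq ?_)
  simp only [Finset.sum_const, Finset.card_univ, Fintype.card_fin, nsmul_eq_mul]
  rw [← mul_assoc, Real.exp_neg, Real.exp_log hN, mul_inv_cancel₀ hN.ne', one_mul]

end Margin

/-! ### Existence of the certificate with high probability -/

section Recovery

variable {M : ℕ} {d : Fin M → ℕ} {α : Fin M → ℕ × ℕ → ℝ} {a D : ℝ}

/-- With high probability there is a dual certificate. -/
lemma Bounds.negligible_not_certificate (h : Bounds d α a D) (hsymm : IsSymmetric d α) {s x : ℝ}
    (hs : s ^ 2 = 1) (hsx : 0 < s * x) (hx : 1 < psi d α x) :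
    Negligible d α fun _ σ => {A | ¬ DualCertificate (similarity A) s (fun i => (σ i : ℝ))} := by
  have ha := h.a_pos
  have hD := h.one_le
  obtain ⟨c, hc, hmargin⟩ := h.negligible_margin hsymm hs hsx hx
  set C := Real.exp D * (M * a) + 2 with hC
  have hC0 : 0 < C := by positivity
  set B := 2 * M * a * D with hB
  have hB0 : 0 ≤ B := by positivity
  -- Each of the four terms of the deviation bound is to be at most `c / 8` times `log N`. The
  -- choices follow in order: `η` from the degrees, `δ` from the density level `η * c / 8`, `ρ` from
  -- `η` and `δ`, and the cut level from `ρ`.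
  set η := min 1 (c / (16 * C)) with hη
  have hη0 : 0 < η := by positivity
  have hη1 : η ≤ 1 := min_le_left _ _
  have hηC : 2 * η * C ≤ c / 8 := by
    have : η ≤ c / (16 * C) := min_le_right _ _
    rw [le_div_iff₀ (by positivity)] at this
    linarith
  obtain ⟨δ, hδ, hdens⟩ := h.negligible_density (κ := η * c / 8) (by positivity)
  -- The first two summands make both `η * ρ * δ` and `η * ρ` at least `1`, so sets with `(η * ρ) ^
  -- 2 * |U| ≤ N` have at most `δ N` elements. The third controls the contribution of the mean.
  set ρ := 1 / (η * δ) + 1 / η + 16 * B / c with hρ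
  have hρ0 : 0 < ρ := by positivity
  have hρδ : 1 ≤ (η * ρ) ^ 2 * δ := by
    have h1 : 1 / δ ≤ η * ρ := by
      have h2 : η * ρ = 1 / δ + 1 + η * (16 * B / c) := by rw [hρ]; field_simp
      have h3 : 0 ≤ η * (16 * B / c) := by positivity
      linarith
    have h4 : 1 ≤ η * ρ := by
      have h2 : η * ρ = 1 / δ + 1 + η * (16 * B / c) := by rw [hρ]; field_simp
      have h3 : 0 ≤ η * (16 * B / c) := by positivity
      have h5 : 0 ≤ 1 / δ := by positivity
      linarith
    rw [div_le_iff₀ hδ] at h1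
    calc (1 : ℝ) ≤ 1 * (η * ρ * δ) := by linarith
      _ ≤ η * ρ * (η * ρ * δ) := by gcongr
      _ = _ := by ring
  have hρB : 2 * B / ρ ≤ c / 8 := by
    rw [div_le_iff₀ hρ0]
    have h1 : 0 ≤ 1 / (η * δ) + 1 / η := by positivity
    have h2 : c / 8 * (16 * B / c) = 2 * B := by field_simp; ring
    have h3 : 0 ≤ c / 8 * (1 / (η * δ) + 1 / η) := by positivity
    rw [hρ, mul_add, h2]
    linarith
  have hcut := h.negligible_cut (κ := c / (8 * ρ ^ 2)) (by positivity)
  refine ((hmargin.union h.negligible_degree).union (hdens.union hcut)).mono ?_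
  filter_upwards [eventually_ge_atTop 2, eventually_ge_atTop (⌈8 * B / c⌉₊),
    tendsto_log_two_mul.eventually_gt_atTop 0] with n hn hnB hℓ0 σ hσ A hA
  by_contra hgood
  apply hA
  simp only [Set.mem_union, Set.mem_ofPred_eq, not_or, not_exists, not_and, not_le, not_lt]
    at hgood
  obtain ⟨⟨g1, g2⟩, g3, g4⟩ := hgood
  set ℓ := Real.log (2 * n : ℕ) with hℓ
  have hN0 : (0 : ℝ) < (2 * n : ℕ) := by exact_mod_cast (by omega : 0 < 2 * n)
  intro z hz hzσ hz0
  have hS : 0 < ∑ i, z i ^ 2 := by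
    obtain ⟨i, hi⟩ := Function.ne_iff.mp hz0
    refine Finset.sum_pos' (fun i _ => sq_nonneg _) ⟨i, Finset.mem_univ i, ?_⟩
    have : z i ≠ 0 := hi
    positivity
  have hform := h.abs_meanSimilarity_form_le hsymm hσ hn z hz hzσ
  have hdev := abs_quadraticForm_sub_le (by omega : 0 < 2 * n) (similarity A)
    (meanSimilarity d α σ) (similarity_nonneg A) (similarity_comm A)
    (pbar := B * ℓ / (2 * n : ℕ)) (Δ := C * ℓ) (κ := c / (8 * ρ ^ 2) * ℓ) (k := η * c / 8 * ℓ)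
    (h.meanSimilarity_nonneg hσ.1) (h.meanSimilarity_le hσ.1 (by omega))
    (fun i => (g2 i).le) (fun u t => (g4 (u, t)).le) hη0 hη1 hρ0 (by positivity)
    (fun U hU => g3 U (by
      have h1 : (U.card : ℝ) ≤ (η * ρ) ^ 2 * δ * U.card := le_mul_of_one_le_left (by positivity) hρδ
      calc (U.card : ℝ) ≤ δ * ((η * ρ) ^ 2 * U.card) := by linarith
        _ ≤ δ * (2 * n : ℕ) := by gcongr)) z
  have e1 : ρ ^ 2 * (c / (8 * ρ ^ 2) * ℓ) + 2 * (B * ℓ / (2 * n : ℕ)) * (2 * n : ℕ) / ρ +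
      2 * η * (C * ℓ) + η * c / 8 * ℓ / η = (c / 8 + 2 * B / ρ + 2 * η * C + c / 8) * ℓ := by
    field_simp
  have e2 : B * ℓ / (2 * n : ℕ) ≤ c / 8 * ℓ := by
    rw [div_le_iff₀ hN0]
    have h1 : 8 * B / c ≤ n := (Nat.le_ceil _).trans (by exact_mod_cast hnB)
    have h2 : (n : ℝ) ≤ (2 * n : ℕ) := by exact_mod_cast (by omega : n ≤ 2 * n)
    have h3 : 8 * B / c ≤ (2 * n : ℕ) := h1.trans h2
    rw [div_le_iff₀ hc] at h3
    nlinarith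
  -- Four deviation terms and the mean form, each at most `c / 8` times `log N`: the total `5 * c /
  -- 8` stays below the margin constant `c`.
  have hW : |∑ i, ∑ j, similarity A i j * (z i * z j)| ≤ 5 * c / 8 * ℓ * ∑ i, z i ^ 2 := by
    have e3 : ∑ i, ∑ j, similarity A i j * (z i * z j) =
        ∑ i, ∑ j, (similarity A i j - meanSimilarity d α σ i j) * (z i * z j) +
          ∑ i, ∑ j, meanSimilarity d α σ i j * (z i * z j) := by
      simp only [← Finset.sum_add_distrib]
      exact Finset.sum_congr rfl fun i _ => Finset.sum_congr rfl fun j _ => by ring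
    rw [e3]
    refine (abs_add_le _ _).trans ((add_le_add hdev hform).trans ?_)
    rw [e1, ← add_mul]
    refine mul_le_mul_of_nonneg_right ?_ hS.le
    have : (c / 8 + 2 * B / ρ + 2 * η * C + c / 8) * ℓ ≤ (c / 8 + c / 8 + c / 8 + c / 8) * ℓ := by
      gcongr
    linarith
  have hleft : ∑ i, ∑ j, s * similarity A i j * (z i * z j) ≤ 5 * c / 8 * ℓ * ∑ i, z i ^ 2 := by
    have e4 : ∑ i, ∑ j, s * similarity A i j * (z i * z j) =
        s * ∑ i, ∑ j, similarity A i j * (z i * z j) := by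
      simp only [Finset.mul_sum, mul_assoc]
    rw [e4]
    refine (le_abs_self _).trans ?_
    have hs1 : |s| = 1 := by
      rw [← sq_eq_sq₀ (abs_nonneg s) zero_le_one, sq_abs, hs, one_pow]
    rw [abs_mul, hs1, one_mul]
    exact hW
  have hright : c * ℓ * ∑ i, z i ^ 2 ≤
      ∑ i, (∑ j, s * similarity A i j * ((σ i : ℝ) * σ j)) * z i ^ 2 := by
    rw [Finset.mul_sum]
    exact Finset.sum_le_sum fun i _ => mul_le_mul_of_nonneg_right (g1 i).le (sq_nonneg _)
  have : 0 < c * ℓ * ∑ i, z i ^ 2 := by positivity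
  linarith

/-! ### From conditional estimates to the joint law, and the theorem -/

lemma finite_balanced (N : ℕ) : (balanced N).Finite := by
  refine (Set.Finite.pi' (t := fun _ : Fin N => ({1, -1} : Set ℤ)) fun _ => by simp).subset ?_
  intro σ hσ i
  simpa using hσ.1 i

/-- Together with finiteness, this makes `uniformOn` a probability measure. -/
lemma nonempty_balanced (n : ℕ) : (balanced (2 * n)).Nonempty := by
  let e : Fin n ⊕ Fin n ≃ Fin (2 * n) := finSumFinEquiv.trans (finCongr (two_mul n).symm)
  refine ⟨fun i => Sum.elim (fun _ => 1) (fun _ => -1) (e.symm i), fun i => ?_, ?_⟩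
  · rcases h : e.symm i with j | j <;> simp [h]
  · simp only [Finset.card_filter]
    rw [e.symm.sum_comp (fun y => if Sum.elim (fun _ => (1 : ℤ)) (fun _ => -1) y = 1 then 1 else 0),
      e.symm.sum_comp (fun y => if Sum.elim (fun _ => (1 : ℤ)) (fun _ => -1) y = -1 then 1 else 0),
      Fintype.sum_sum_type, Fintype.sum_sum_type]
    simp

/-- An event whose complement is conditionally negligible has probability tending to one. -/
lemma tendsto_law_of_negligible
    (good : ∀ n : ℕ, Set ((Fin (2 * n) → ℤ) × Hypergraph (2 * n) d))
    (h : Negligible d α fun n σ => {A | (σ, A) ∉ good n}) :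
    Tendsto (fun n => (law (2 * n) d α).real (good n)) atTop (𝓝 1) := by
  have hprob : ∀ n, IsProbabilityMeasure (law (2 * n) d α) := by
    intro n
    have := isProbabilityMeasure_uniformOn (finite_balanced (2 * n)) (nonempty_balanced n)
    have : IsMarkovKernel (Kernel.ofFunOfCountable (condLaw (2 * n) d α)) :=
      ⟨fun σ => inferInstanceAs (IsProbabilityMeasure (condLaw (2 * n) d α σ))⟩
    unfold law
    infer_instance
  rw [Metric.tendsto_nhds]
  intro ε hε
  filter_upwards [h (ε / 2) (by positivity)] with n hn
  have := hprob n
  -- The sample space is countable, so nothing has to be known about the measurability of the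
  -- algorithm.
  have hmeas : MeasurableSet (good n) := (Set.to_countable _).measurableSet
  have hcompl : (law (2 * n) d α).real (good n)ᶜ ≤ ε / 2 := by
    have h1 : law (2 * n) d α (good n)ᶜ ≤ ENNReal.ofReal (ε / 2) := by
      have := isProbabilityMeasure_uniformOn (finite_balanced (2 * n)) (nonempty_balanced n)
      have : IsMarkovKernel (Kernel.ofFunOfCountable (condLaw (2 * n) d α)) :=
        ⟨fun σ => inferInstanceAs (IsProbabilityMeasure (condLaw (2 * n) d α σ))⟩
      unfold law
      rw [Measure.compProd_apply hmeas.compl]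
      have hae : ∀ᵐ σ ∂uniformOn (balanced (2 * n)), σ ∈ balanced (2 * n) :=
        ae_cond_mem (finite_balanced (2 * n)).measurableSet
      calc _ ≤ ∫⁻ _σ, ENNReal.ofReal (ε / 2) ∂uniformOn (balanced (2 * n)) := by
            refine lintegral_mono_ae ?_
            filter_upwards [hae] with σ hσ
            have h2 := hn σ hσ
            rw [measureReal_def] at h2
            exact (ENNReal.le_ofReal_iff_toReal_le (measure_ne_top _ _) (by positivity)).mpr h2
        _ = _ := by simp
    exact ENNReal.toReal_le_of_le_ofReal (by positivity) h1
  rw [probReal_compl_eq_one_sub hmeas] at hcompl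
  have h3 : (law (2 * n) d α).real (good n) ≤ 1 := measureReal_le_one
  rw [Real.dist_eq, abs_lt]
  constructor <;> linarith

end Recovery

end HSBM

theorem theorem1 {M : ℕ} (d : Fin M → ℕ) (α : Fin M → ℕ × ℕ → ℝ)
    (hd : ∀ m, 2 ≤ d m)
    (hα : ∀ m, ∀ r ≤ d m, 0 < α m (r, d m - r))
    (hsymm : HSBM.IsSymmetric d α)
    (hI : 1 < HSBM.information d α) :
    HSBM.assortativity d α ≠ 0 ∧
    Filter.Tendsto
      (fun n : ℕ => (HSBM.law (2 * n) d α).real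
        {p | HSBM.Recovers
          (HSBM.sdpOutputs (HSBM.similarity p.2)
            (SignType.sign (HSBM.assortativity d α) : ℝ)) p.1})
      Filter.atTop (nhds 1) := by
  -- No maximizer of `ψ` is needed: any point where `ψ` exceeds `1` serves as Chernoff parameter,
  -- and the tangent bound gives it the sign of `ξ`.
  obtain ⟨x, hx⟩ := exists_lt_of_lt_ciSup hI
  have hξx : 0 < HSBM.assortativity d α * x :=
    zero_lt_one.trans (hx.trans_le (HSBM.psi_le_assortativity_mul hα x))
  have hξ : HSBM.assortativity d α ≠ 0 := left_ne_zero_of_mul hξx.ne'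
  refine ⟨hξ, ?_⟩
  obtain ⟨a, D, hb⟩ := HSBM.exists_bounds hd hα
  set s : ℝ := (SignType.sign (HSBM.assortativity d α) : ℝ) with hs
  have hs2 : s ^ 2 = 1 ∧ 0 < s * x := by
    rcases lt_or_gt_of_ne hξ with h | h
    · rw [hs, sign_neg h]
      have : x < 0 := neg_of_mul_pos_right hξx h.le
      simp [this]
    · rw [hs, sign_pos h]
      have : 0 < x := pos_of_mul_pos_right hξx h.le
      simp [this]
  refine HSBM.tendsto_law_of_negligible _
    ((hb.negligible_not_certificate hsymm hs2.1 hs2.2 hx).mono ?_)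
  filter_upwards [Filter.eventually_ge_atTop 1] with n hn σ hσ A hA hcert
  exact hA (hcert.recovers hσ (by omega) (HSBM.similarity_comm A) (HSBM.similarity_self A))
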